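/- Let $p,p'$ be coprime positive integers with $1<t<2$, where $t=p'/p$, and let $1\le r\le p-1$, $1\le s\le p'-1$. Put $$\Delta_{a,s}=\frac{(at-s)^2-(t-1)^2}{4t},\qquad (q)_m=\prod_{i=1}^m(1-q^i),\qquad (q)_\infty=\prod_{i\ge1}(1-q^i),$$ and let $b=b(s)\in\{1,\dots,p-1\}$ be a point at which $a\mapsto\Delta_{a,s}$ attains its minimum on $\{1,\dots,p-1\}$ (any such point, if there are two). For integers $a$, $a'=a\pm1$, $a''=a'\pm1$ in $\{1,\dots,p-1\}$ define the local weights $$w(a,a\pm1,a\pm2)=\tfrac t2,\quad w(a,a+1,a)=2-\tfrac t2+[ta]-ta,\quad w(a,a-1,a)=1-\tfrac t2-[ta]+ta,$$ where $[x]$ is the integer part of $x$. A monomial of length $L\ge0$ is a sequence $m=(\sigma_1,m_1;\dots;\sigma_L,m_L)$ with $\sigma_i=\pm1$, $m_i\in\mathbb Q$. Set $r_L=b$ and $r_{i-1}=r_i+\sigma_i$ for $1\le i\le L$. The monomial is admissible if $1\le r_i\le p-1$, $-m_i\in\Delta_{r_{i-1},s}-\Delta_{r_i,s}+\mathbb Z$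 and $-m_i+m_{i+1}\in w(r_{i-1},r_i,r_{i+1})+\mathbb Z_{\ge0}$ for $1\le i\le L-1$, and, when $L\ge1$, $-m_L\in\Delta_{r_{L-1},s}-\Delta_{b,s}+\mathbb Z_{\ge0}$; the empty monomial is admissible. Let $B_{r,s}$ be the set of admissible monomials with $r_0=r$, let $d(m)=\Delta_{b,s}-\sum_i m_i$, and let $$\tilde\chi_{r,s}(q)=\sum_{m\in B_{r,s}}q^{d(m)}.$$ Let $\chi_{r,s}(q)$ be the bosonic (Rocha-Caridi) character of the irreducible module $M_{r,s}$ of the $(p,p')$ Virasoro minimal series, $$\chi_{r,s}(q)=\frac{q^{\Delta_{r,s}}}{(q)_\infty}\Bigl(\sum_{n\in\mathbb Z}q^{pp'n^2+(p'r-ps)n}-\sum_{n\in\mathbb Z}q^{pp'n^2+(p'r+ps)n+rs}\Bigr).$$ For $L\ge0$ let $$Y^{(L)}_{a,a',c}(q)=\sum q^{\sum_{i=1}^{L}i\,w(r_{i-1},r_i,r_{i+1})},$$ the sum being over all sequences $(r_0,\dots,r_{L+1})$ in $\{1,\dots,p-1\}$ with $r_{i+1}=r_i\pm1$, $r_0=a$,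 $r_L=a'$, $r_{L+1}=c$. For integers $L\ge0$ let $$F_L(q)=\sum_{n\in\mathbb Z}\left(q^{A_n}\begin{bmatrix}L\\ \frac{L-r+b}2-pn\end{bmatrix}-q^{B_n}\begin{bmatrix}L\\ \frac{L-r-b}2-pn\end{bmatrix}\right),$$ $$A_n=p(p'-p)n^2+\{(p'-p)r-p(s-b)\}n,\quad B_n=p(p'-p)n^2+\{(p'-p)r+p(s-b)\}n+r(s-b),$$ where $\begin{bmatrix}L\\k\end{bmatrix}=\frac{(q)_L}{(q)_k(q)_{L-k}}$ if $k$ is an integer with $0\le k\le L$, and it is $0$ otherwise. Then, as identities of formal series in rational powers of $q$, $$\tilde\chi_{r,s}(q)=\chi_{r,s}(q),$$ $$\chi_{r,s}(q)=\delta_{r,b}\,q^{\Delta_{b,s}}+\sum_{L\ge1}\frac{q^{\Delta_{b,s}}}{(q)_L}\sum_{\tau=\pm1}q^{L(\Delta_{b+\tau,s}-\Delta_{b,s})}\,Y^{(L-1)}_{r,b+\tau,b}(q),$$ $$\chi_{r,s}(q)=q^{\Delta_{r,s}}\sum_{L\ge0}\frac{q^{(L^2-(r-b)^2)/4}}{(q)_L}\,F_L(q).$$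 Moreover, for every $L\ge0$ all coefficients of $F_L(q)$ are nonnegative. -/

import Mathlib

namespace VirasoroMonomials

/-! ### Formal series in `q` with rational exponents -/

/-- Formal series in `q` with rational exponents and rational coefficients. -/
abbrev QSeries := HahnSeries ℚ ℚ

/-- The monomial `q ^ x`. -/
noncomputable def qpow (x : ℚ) : QSeries := HahnSeries.single x 1

/-- `F` is the sum of the (possibly infinite) family `f`, in the sense of formal series:
the family is summable and `F` is its coefficientwise sum. -/
def HasFormalSum {ι : Type*} (f : ι → QSeries) (F : QSeries) : Prop :=
  ∃ S : HahnSeries.SummableFamily ℚ ℚ ι, (∀ i, S i = f i) ∧ S.hsum = F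

open Classical in
/-- The sum of a summable family of formal series (and `0` if the family is not summable). -/
noncomputable def formalSum {ι : Type*} (f : ι → QSeries) : QSeries :=
  if h : ∃ F, HasFormalSum f F then h.choose else 0

theorem HasFormalSum.unique {ι : Type*} {f : ι → QSeries} {F G : QSeries}
    (hF : HasFormalSum f F) (hG : HasFormalSum f G) : F = G := by
  obtain ⟨S, hS, rfl⟩ := hF
  obtain ⟨T, hT, rfl⟩ := hG
  have : S = T := by
    ext1 i
    rw [hS, hT]
  rw [this]

theorem HasFormalSum.formalSum_eq {ι : Type*} {f : ι → QSeries} {F : QSeries}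
    (hF : HasFormalSum f F) : formalSum f = F := by
  have h : ∃ F, HasFormalSum f F := ⟨F, hF⟩
  rw [formalSum, dif_pos h]
  exact h.choose_spec.unique hF

/-- `(q)_m = (1 - q)(1 - q ^ 2) ⋯ (1 - q ^ m)`. -/
noncomputable def qPoch (m : ℕ) : QSeries :=
  ∏ i ∈ Finset.range m, (1 - qpow ((i : ℚ) + 1))

open scoped PowerSeries.WithPiTopology in
/-- `(q)_∞ = ∏_{i ≥ 1} (1 - q ^ i)`. -/
noncomputable def qPochInf : QSeries :=
  HahnSeries.ofPowerSeries ℚ ℚ (∏' i : ℕ, (1 - (PowerSeries.X : PowerSeries ℚ) ^ (i + 1)))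

/-- `1 / (q)_m` for an integer `m`, with `1 / (q)_m = 0` for `m < 0`. -/
noncomputable def invQPoch (m : ℤ) : QSeries :=
  if m < 0 then 0 else (qPoch m.toNat)⁻¹

/-- The Gaussian binomial coefficient `(q)_L / ((q)_x (q)_{L - x})`; it is `0` when the lower
entry `x` is not an integer, is negative, or exceeds `L`. -/
noncomputable def gaussBinom (L : ℕ) (x : ℚ) : QSeries :=
  if x = (⌊x⌋ : ℚ) then qPoch L * invQPoch ⌊x⌋ * invQPoch ((L : ℤ) - ⌊x⌋) else 0

/-! ### Data of the minimal series; throughout `t = p' / p` -/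

/-- The conformal dimension `Δ_{r,s} = ((r t - s)² - (t - 1)²) / (4 t)`. -/
def confDim (p p' : ℕ) (r s : ℤ) : ℚ :=
  let t : ℚ := (p' : ℚ) / p
  ((r * t - s) ^ 2 - (t - 1) ^ 2) / (4 * t)

/-- `b` is an admissible value of `b(s)`: it lies in `{1, …, p - 1}` and `Δ_{r,s}`, as a function
of `r ∈ {1, …, p - 1}`, attains its minimum at `r = b`. -/
def IsMinimizer (p p' : ℕ) (s b : ℤ) : Prop :=
  b ∈ Set.Icc (1 : ℤ) (p - 1) ∧
    ∀ r ∈ Set.Icc (1 : ℤ) (p - 1), confDim p p' b s ≤ confDim p p' r s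

/-- The local weight `w(r, r', r'')`, for `r' = r ± 1` and `r'' = r' ± 1`. -/
def weight (p p' : ℕ) (r r' r'' : ℤ) : ℚ :=
  let t : ℚ := (p' : ℚ) / p
  if r'' = r then
    if r' = r + 1 then 2 - t / 2 + ⌊t * r⌋ - t * r else 1 - t / 2 - ⌊t * r⌋ + t * r
  else t / 2

/-! ### Admissible monomials -/

/-- A monomial `(σ_1, m_1; …; σ_L, m_L)`: signs `σ_i = ±1` and rational numbers `m_i`.
The entries are indexed from `0`: `sign i` and `mode i` are `σ_{i+1}` and `m_{i+1}`. -/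
structure Monomial where
  len : ℕ
  sign : Fin len → ℤˣ
  mode : Fin len → ℚ

/-- The associated one-dimensional configuration `r(m)_i`, `0 ≤ i ≤ L`, determined by
`r(m)_L = b` and `r(m)_{i-1} = r(m)_i + σ_i`. -/
def Monomial.config (m : Monomial) (b : ℤ) (i : ℕ) : ℤ :=
  b + ∑ j ∈ Finset.univ.filter (fun j : Fin m.len => i ≤ (j : ℕ)), (m.sign j : ℤ)

/-- The degree `d(m) = Δ_{b,s} - ∑ m_i`. -/
def Monomial.degree (p p' : ℕ) (s b : ℤ) (m : Monomial) : ℚ :=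
  confDim p p' b s - ∑ i, m.mode i

/-- Admissibility of a type `s` monomial (with `b = b(s)`). -/
structure Monomial.IsAdmissible (p p' : ℕ) (s b : ℤ) (m : Monomial) : Prop where
  config_mem : ∀ i : ℕ, 1 ≤ i → i < m.len → m.config b i ∈ Set.Icc (1 : ℤ) (p - 1)
  mode_mem : ∀ i : Fin m.len, (i : ℕ) + 1 < m.len → ∃ k : ℤ,
    -m.mode i = confDim p p' (m.config b i) s - confDim p p' (m.config b (i + 1)) s + k
  last_mode_mem : ∀ i : Fin m.len, (i : ℕ) + 1 = m.len → ∃ k : ℕ,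
    -m.mode i = confDim p p' (m.config b i) s - confDim p p' b s + k
  gap_mem : ∀ i j : Fin m.len, (j : ℕ) = i + 1 → ∃ k : ℕ,
    -m.mode i + m.mode j =
      weight p p' (m.config b i) (m.config b (i + 1)) (m.config b (i + 2)) + k

/-- The set `B_{r,s}` of type `s` admissible monomials `m` with `r(m)_0 = r`. -/
def admissibleMonomials (p p' : ℕ) (s b r : ℤ) : Set Monomial :=
  {m | m.IsAdmissible p p' s b ∧ m.config b 0 = r}

/-! ### One-dimensional configuration sums -/

/-- The set `C^{(L)}_{a,c}` of sequences `(r_0, …, r_L)` in `{1, …, p - 1}` with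
`r_{i+1} = r_i ± 1`, `r_0 = a` and `r_L = c`. -/
noncomputable def configs (p L : ℕ) (a c : ℤ) : Finset (Fin (L + 1) → ℤ) :=
  (Fintype.piFinset fun _ => Finset.Icc (1 : ℤ) (p - 1)).filter fun ρ =>
    (∀ i : Fin L, ρ i.succ = ρ i.castSucc + 1 ∨ ρ i.succ = ρ i.castSucc - 1) ∧
      ρ 0 = a ∧ ρ (Fin.last L) = c

/-- `∑_{i=1}^{L} i w(r_{i-1}, r_i, r_{i+1})` for a sequence `(r_0, …, r_{L+1})`. -/
def configWeight (p p' L : ℕ) (ρ : Fin (L + 1 + 1) → ℤ) : ℚ :=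
  ∑ i : Fin L, ((i : ℚ) + 1) *
    weight p p' (ρ i.castSucc.castSucc) (ρ i.castSucc.succ) (ρ i.succ.succ)

/-- The one-dimensional configuration sum `Y^{(L)}_{a,b,c}(q)`, over all
`(r_0, …, r_{L+1}) ∈ C^{(L+1)}_{a,c}` with `r_L = b`. -/
noncomputable def configSum (p p' L : ℕ) (a b c : ℤ) : QSeries :=
  ∑ ρ ∈ (configs p (L + 1) a c).filter (fun ρ => ρ (Fin.last L).castSucc = b),
    qpow (configWeight p p' L ρ)

/-- The contribution of length `L` to the generating function of admissible monomials:
`δ_{r,b} q^{Δ_{b,s}}` for `L = 0`, and for `L ≥ 1`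
`q^{Δ_{b,s}} / (q)_L · ∑_{τ = ±1} q^{L (Δ_{b+τ,s} - Δ_{b,s})} Y^{(L-1)}_{r,b+τ,b}(q)`. -/
noncomputable def configSumTerm (p p' : ℕ) (r s b : ℤ) : ℕ → QSeries
  | 0 => if r = b then qpow (confDim p p' b s) else 0
  | L + 1 => qpow (confDim p p' b s) * (qPoch (L + 1))⁻¹ *
      ∑ τ : ℤˣ, qpow (((L : ℚ) + 1) * (confDim p p' (b + τ) s - confDim p p' b s)) *
        configSum p p' L r (b + τ) b

/-! ### The character -/

/-- The bosonic (Rocha-Caridi) formula for the character `χ_{r,s}(q)` of the irreducible Virasoro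
module `M_{r,s}` of the `(p, p')` minimal series. -/
noncomputable def character (p p' : ℕ) (r s : ℤ) : QSeries :=
  qpow (confDim p p' r s) * qPochInf⁻¹ *
    (formalSum (fun n : ℤ => qpow ((p * p' * n ^ 2 + (p' * r - p * s) * n : ℤ) : ℚ)) -
      formalSum (fun n : ℤ => qpow ((p * p' * n ^ 2 + (p' * r + p * s) * n + r * s : ℤ) : ℚ)))

/-- The sum over `n` in the term of index `L` of the fermionic formula; all but finitely many
summands vanish. -/
noncomputable def fermionicSum (p p' : ℕ) (r s b : ℤ) (L : ℕ) : QSeries :=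
  ∑ᶠ n : ℤ,
    (qpow ((p * (p' - p) * n ^ 2 + ((p' - p) * r - p * (s - b)) * n : ℤ) : ℚ) *
        gaussBinom L (((L : ℚ) - r + b) / 2 - p * n) -
      qpow ((p * (p' - p) * n ^ 2 + ((p' - p) * r + p * (s - b)) * n + r * (s - b) : ℤ) : ℚ) *
        gaussBinom L (((L : ℚ) - r - b) / 2 - p * n))

/-- A family of monomials `q ^ (e i)` with natural exponents and finite fibres is summable. -/
theorem hasFormalSum_qpow_nat {ι : Type*} (e : ι → ℕ) (he : ∀ k, {i | e i = k}.Finite) :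
    HasFormalSum (fun i => qpow (e i)) (formalSum fun i => qpow (e i)) := by
  have h : ∃ F, HasFormalSum (fun i => qpow (e i)) F := by
    refine ⟨_, ⟨fun i => qpow (e i), ?_, ?_⟩, fun i => rfl, rfl⟩
    · have hN : (Set.range fun n : ℕ => (n : ℚ)).IsPWO := by
        rw [← Set.image_univ]
        exact (Set.isPWO_of_wellQuasiOrderedLE _).image_of_monotone Nat.mono_cast
      refine hN.mono (Set.iUnion_subset fun i x hx => ⟨e i, ?_⟩)
      have := HahnSeries.support_single_subset hx
      simpa using this.symm
    · intro g
      obtain ⟨k, hk⟩ | hg := em (∃ k : ℕ, (k : ℚ) = g)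
      · refine (he k).subset fun i hi => ?_
        by_contra hne
        refine hi (HahnSeries.coeff_single_of_ne ?_)
        rw [← hk]
        exact_mod_cast Ne.symm hne
      · refine Set.finite_empty.subset fun i hi => ?_
        exact hi (HahnSeries.coeff_single_of_ne fun h => hg ⟨e i, h.symm⟩)
  obtain ⟨F, hF⟩ := h
  rwa [hF.formalSum_eq]

theorem finite_quadratic_eq {a b c : ℤ} (ha : 0 < a) (k : ℤ) :
    {n : ℤ | a * n ^ 2 + b * n + c = k}.Finite := by
  refine (Set.finite_Icc (-(|b| + |c - k| + 1)) (|b| + |c - k| + 1)).subset fun n hn => ?_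
  simp only [Set.mem_ofPred_eq] at hn
  rw [Set.mem_Icc, ← abs_le]
  by_contra! h
  have hb := abs_nonneg b
  have hc := abs_nonneg (c - k)
  have h1 : a * n ^ 2 = -(b * n) - (c - k) := by linarith
  have h2 : a * |n| ^ 2 ≤ |b| * |n| + |c - k| := by
    rw [sq_abs, h1, ← abs_mul]
    have := neg_abs_le (b * n)
    have := neg_abs_le (c - k)
    linarith
  nlinarith

/-- Both theta sums in the bosonic formula are sums of summable families. -/
theorem hasFormalSum_theta {p p' : ℕ} {r s : ℤ} (hr : r ∈ Set.Icc (1 : ℤ) (p - 1))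
    (hs : s ∈ Set.Icc (1 : ℤ) (p' - 1)) :
    HasFormalSum (fun n : ℤ => qpow ((p * p' * n ^ 2 + (p' * r - p * s) * n : ℤ) : ℚ))
        (formalSum fun n : ℤ => qpow ((p * p' * n ^ 2 + (p' * r - p * s) * n : ℤ) : ℚ)) ∧
      HasFormalSum
        (fun n : ℤ => qpow ((p * p' * n ^ 2 + (p' * r + p * s) * n + r * s : ℤ) : ℚ))
        (formalSum fun n : ℤ =>
          qpow ((p * p' * n ^ 2 + (p' * r + p * s) * n + r * s : ℤ) : ℚ)) := by
  obtain ⟨hr1, hr2⟩ := hr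
  obtain ⟨hs1, hs2⟩ := hs
  have key : ∀ (b c : ℤ), (∀ n : ℤ, 0 ≤ p * p' * n ^ 2 + b * n + c) →
      HasFormalSum (fun n : ℤ => qpow ((p * p' * n ^ 2 + b * n + c : ℤ) : ℚ))
        (formalSum fun n : ℤ => qpow ((p * p' * n ^ 2 + b * n + c : ℤ) : ℚ)) := by
    intro b c h
    have hf : (fun n : ℤ => qpow ((p * p' * n ^ 2 + b * n + c : ℤ) : ℚ)) =
        fun n : ℤ => qpow (((p * p' * n ^ 2 + b * n + c : ℤ).toNat : ℕ) : ℚ) := by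
      funext n
      congr 1
      exact_mod_cast congrArg (Int.cast : ℤ → ℚ) (Int.toNat_of_nonneg (h n)).symm
    rw [hf]
    refine hasFormalSum_qpow_nat _ fun k => ?_
    refine (finite_quadratic_eq (a := p * p') (b := b) (c := c) (by nlinarith) k).subset
      fun n hn => ?_
    simp only [Set.mem_ofPred_eq] at hn ⊢
    rw [← hn, Int.toNat_of_nonneg (h n)]
  constructor
  · have := key (p' * r - p * s) 0 ?_
    · simpa only [add_zero] using this
    · intro n
      rcases lt_trichotomy n 0 with hn | rfl | hn
      · nlinarith [mul_nonneg (show (0 : ℤ) ≤ -n by omega) (mul_nonneg (show (0 : ℤ) ≤ p by omega)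
          (show (0 : ℤ) ≤ -p' * n - p' by nlinarith)), mul_nonneg (show (0 : ℤ) ≤ -n by omega)
          (mul_nonneg (show (0 : ℤ) ≤ p' by omega) (show (0 : ℤ) ≤ p - r by omega)),
          mul_nonneg (show (0 : ℤ) ≤ -n by omega)
          (mul_nonneg (show (0 : ℤ) ≤ p by omega) (show (0 : ℤ) ≤ s by omega))]
      · simp
      · nlinarith [mul_nonneg hn.le (mul_nonneg (show (0 : ℤ) ≤ p by omega)
          (show (0 : ℤ) ≤ p' * n - p' by nlinarith)), mul_nonneg hn.le
          (mul_nonneg (show (0 : ℤ) ≤ p by omega) (show (0 : ℤ) ≤ p' - s by omega)),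
          mul_nonneg hn.le
          (mul_nonneg (show (0 : ℤ) ≤ p' by omega) (show (0 : ℤ) ≤ r by omega))]
  · refine key _ _ fun n => ?_
    have hfac : (p : ℤ) * p' * n ^ 2 + (p' * r + p * s) * n + r * s =
        (p * n + r) * (p' * n + s) := by ring
    rw [hfac]
    rcases lt_or_ge n 0 with hn | hn
    · exact mul_nonneg_of_nonpos_of_nonpos (by nlinarith) (by nlinarith)
    · exact mul_nonneg (by nlinarith) (by nlinarith)

end VirasoroMonomials

open VirasoroMonomials

/-! Every series in the theorem is a sum over the length `L`, and the terms are matched length by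
length.

An admissible monomial is a path `r_0, …, r_L = b` together with the amounts by which its gaps
exceed their least values. The degree is linear in these excesses, with coefficients `1, …, L`, so
summing over them gives `1 / (q)_L` times a configuration sum (`admissibleEquiv`,
`degree_monomialOf`, `sum_minEnergy`).

Configuration sums are computed by the method of images. On the whole line the recursion obtained by
deleting the last vertex is solved by one Gaussian binomial times a power of `q` (`freeUp`,
`freeDown`). Since `1 < t < 2`, `⌊t b⌋` increases by 1 or 2 when `b` increases by 1, and the two
cases are the two q-Pascal rules. The alternating sum over the images of the starting point under
reflections in `0` and `p` satisfies the same recursion, the same initial condition and the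
vanishing at the walls, hence is the configuration sum (`configSum_eq_bosonic`). Minimality of `b`
forces `⌊t b⌋` to be `s` or `s - 1`. The two possible last steps into `b` then merge by one more
Pascal rule (`free_closing_step`), and what remains is a power of `q` times `F_L`. Configuration
sums have nonnegative coefficients, hence so does `F_L`.

Finally, for a fixed image the sum over `L` of `q^((L²-d²)/4) / (q)_L · [L, (L+d)/2]` is `1 /
(q)_∞`, independently of `d`, by the Durfee rectangle identity (`hasFormalSum_gaussBinom`).
Interchanging the sums over `L` and over images turns the fermionic sum into the bosonic character.
-/

namespace VirasoroMonomials

/-! ### Summable families -/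

namespace HasFormalSum

variable {ι κ : Type*} {f g : ι → QSeries} {F G : QSeries}

theorem coeff_eq (h : HasFormalSum f F) (d : ℚ) : F.coeff d = ∑ᶠ i, (f i).coeff d := by
  obtain ⟨S, hS, rfl⟩ := h
  simp [HahnSeries.SummableFamily.coeff_hsum, hS]

theorem isPWO (h : HasFormalSum f F) : (⋃ i, (f i).support).IsPWO := by
  obtain ⟨S, hS, rfl⟩ := h
  simpa [hS] using S.isPWO_iUnion_support

theorem finite (h : HasFormalSum f F) (d : ℚ) : {i | (f i).coeff d ≠ 0}.Finite := by
  obtain ⟨S, hS, rfl⟩ := h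
  simp only [← hS]
  exact S.finite_co_support d

theorem intro (h₁ : (⋃ i, (f i).support).IsPWO) (h₂ : ∀ d, {i | (f i).coeff d ≠ 0}.Finite)
    (h₃ : ∀ d, F.coeff d = ∑ᶠ i, (f i).coeff d) : HasFormalSum f F := by
  refine ⟨⟨f, h₁, h₂⟩, fun i => rfl, ?_⟩
  ext d
  rw [HahnSeries.SummableFamily.coeff_hsum, h₃]
  rfl

theorem congr (h : HasFormalSum f F) (hfg : ∀ i, f i = g i) (hFG : F = G) :
    HasFormalSum g G := by
  rwa [← hFG, ← funext hfg]

theorem comp_equiv (h : HasFormalSum f F) (e : κ ≃ ι) : HasFormalSum (fun i => f (e i)) F := by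
  obtain ⟨S, hS, rfl⟩ := h
  exact ⟨S.Equiv e.symm, fun i => hS _, S.hsum_equiv _⟩

theorem sub (hf : HasFormalSum f F) (hg : HasFormalSum g G) :
    HasFormalSum (fun i => f i - g i) (F - G) := by
  obtain ⟨S, hS, rfl⟩ := hf
  obtain ⟨T, hT, rfl⟩ := hg
  exact ⟨S - T, fun i => by simp [hS, hT], HahnSeries.SummableFamily.hsum_sub⟩

theorem mul {g : κ → QSeries} (hf : HasFormalSum f F) (hg : HasFormalSum g G) :
    HasFormalSum (fun x : ι × κ => f x.1 * g x.2) (F * G) := by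
  obtain ⟨S, hS, rfl⟩ := hf
  obtain ⟨T, hT, rfl⟩ := hg
  refine ⟨S.mul T, fun i => ?_, HahnSeries.SummableFamily.hsum_mul S T⟩
  change S i.1 * T i.2 = _
  rw [hS, hT]

theorem of_fintype [Fintype ι] (f : ι → QSeries) : HasFormalSum f (∑ i, f i) := by
  classical
  refine ⟨HahnSeries.SummableFamily.ofFinsupp (Finsupp.equivFunOnFinite.symm f), fun i => rfl, ?_⟩
  rw [HahnSeries.SummableFamily.hsum_ofFinsupp, Finsupp.sum_fintype _ _ (by simp)]
  rfl

theorem mul_left (c : QSeries) (hf : HasFormalSum f F) :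
    HasFormalSum (fun i => c * f i) (c * F) := by
  have h := ((of_fintype fun _ : Unit => c).mul hf).comp_equiv (Equiv.punitProd ι).symm
  simpa using h

theorem of_injective {g : κ → QSeries} {φ : ι → κ} (hφ : Function.Injective φ)
    (h : HasFormalSum (fun i => g (φ i)) F) (h0 : ∀ k, k ∉ Set.range φ → g k = 0) :
    HasFormalSum g F := by
  obtain ⟨S, hS, rfl⟩ := h
  refine ⟨S.embDomain ⟨φ, hφ⟩, fun k => ?_, S.hsum_embDomain _⟩
  by_cases hk : k ∈ Set.range φ
  · obtain ⟨i, rfl⟩ := hk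
    exact (S.embDomain_image ⟨φ, hφ⟩).trans (hS i)
  · rw [h0 k hk]
    exact S.embDomain_of_notMem_range ⟨φ, hφ⟩ hk

end HasFormalSum

/-! ### Iterated summation and nonnegativity -/

theorem finsum_sigma {ι M : Type*} [AddCommMonoid M] {κ : ι → Type*} (f : (Σ i, κ i) → M)
    (hf : {x | f x ≠ 0}.Finite) : ∑ᶠ x, f x = ∑ᶠ i, ∑ᶠ k, f ⟨i, k⟩ := by
  classical
  set T := hf.toFinset with hT
  have hmem : ∀ x, x ∈ T ↔ f x ≠ 0 := fun x => by simp [hT]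
  set c : ∀ i, Finset (κ i) := fun i => T.preimage (Sigma.mk i) sigma_mk_injective.injOn with hc
  have hinner : ∀ i, ∑ᶠ k, f ⟨i, k⟩ = ∑ k ∈ c i, f ⟨i, k⟩ := fun i =>
    finsum_eq_sum_of_support_subset _ fun k hk => by simpa [hc, hmem] using hk
  rw [finsum_congr hinner, finsum_eq_sum_of_support_subset (s := T) _ fun x hx => by
    simpa [hmem] using hx]
  rw [finsum_eq_sum_of_support_subset (s := T.image Sigma.fst), Finset.sum_sigma']
  · refine Finset.sum_subset_zero_on_sdiff ?_ ?_ fun _ _ => rfl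
    · rintro ⟨i, k⟩ hx
      simp only [Finset.mem_sigma, Finset.mem_image, hc, Finset.mem_preimage]
      exact ⟨⟨_, hx, rfl⟩, hx⟩
    · rintro ⟨i, k⟩ hx
      simp only [Finset.mem_sdiff, hmem, not_not] at hx
      exact hx.2
  · intro i hi
    obtain ⟨k, hk, -⟩ := Finset.exists_ne_zero_of_sum_ne_zero hi
    simp only [hc, Finset.mem_preimage] at hk
    simpa using ⟨k, hk⟩

/-- All coefficients of the series are nonnegative. -/
def NonnegCoeff (F : QSeries) : Prop := ∀ d, 0 ≤ F.coeff d

theorem NonnegCoeff.mul {F G : QSeries} (hF : NonnegCoeff F) (hG : NonnegCoeff G) :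
    NonnegCoeff (F * G) := fun d => by
  rw [HahnSeries.coeff_mul]
  exact Finset.sum_nonneg fun x _ => mul_nonneg (hF _) (hG _)

theorem nonnegCoeff_zero : NonnegCoeff 0 := fun _ => le_rfl

theorem nonnegCoeff_qpow (x : ℚ) : NonnegCoeff (qpow x) := fun d => by
  classical
  rw [qpow, HahnSeries.coeff_single]
  split_ifs <;> norm_num

theorem nonnegCoeff_sum {ι : Type*} {s : Finset ι} {f : ι → QSeries}
    (h : ∀ i ∈ s, NonnegCoeff (f i)) : NonnegCoeff (∑ i ∈ s, f i) := fun d => by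
  rw [HahnSeries.coeff_sum]
  exact Finset.sum_nonneg fun i hi => h i hi d

theorem HasFormalSum.nonnegCoeff {ι : Type*} {f : ι → QSeries} {F : QSeries}
    (h : HasFormalSum f F) (hf : ∀ i, NonnegCoeff (f i)) : NonnegCoeff F := fun d => by
  rw [h.coeff_eq]
  exact finsum_nonneg fun i => hf i d

/-- A family with nonnegative coefficients may be summed fibrewise. -/
theorem HasFormalSum.of_sigma {ι : Type*} {κ : ι → Type*} {f : (Σ i, κ i) → QSeries}
    {G : ι → QSeries} {F : QSeries} (hf : ∀ x, NonnegCoeff (f x))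
    (hG : ∀ i, HasFormalSum (fun k => f ⟨i, k⟩) (G i)) (hF : HasFormalSum G F) :
    HasFormalSum f F := by
  -- Without negative coefficients nothing cancels: a nonzero coefficient of a member survives in
  -- its fibre sum. Support and finiteness conditions therefore pass from `G` back to `f`.
  have key : ∀ i k d, (f ⟨i, k⟩).coeff d ≠ 0 → (G i).coeff d ≠ 0 := by
    intro i k d h h0
    rw [(hG i).coeff_eq d] at h0
    have h1 := single_le_finsum k ((hG i).finite d) fun k => hf ⟨i, k⟩ d
    exact h (le_antisymm (h0 ▸ h1) (hf _ d))
  have hfin : ∀ d, {x | (f x).coeff d ≠ 0}.Finite := by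
    intro d
    refine ((hF.finite d).biUnion (t := fun i => Sigma.mk i '' {k | (f ⟨i, k⟩).coeff d ≠ 0})
      fun i _ => ((hG i).finite d).image _).subset ?_
    rintro ⟨i, k⟩ h
    exact Set.mem_biUnion (key i k d h) ⟨k, h, rfl⟩
  refine .intro (hF.isPWO.mono ?_) hfin ?_
  · rintro d hd
    simp only [Set.mem_iUnion] at hd ⊢
    obtain ⟨⟨i, k⟩, hd⟩ := hd
    exact ⟨i, key i k d hd⟩
  · intro d
    rw [hF.coeff_eq d, finsum_sigma _ (hfin d)]
    exact finsum_congr fun i => (hG i).coeff_eq d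

/-- Fibre sums of a summable family are summable, with the same sum. -/
theorem HasFormalSum.sigma {ι : Type*} {κ : ι → Type*} {f : (Σ i, κ i) → QSeries}
    {G : ι → QSeries} {F : QSeries} (hf : HasFormalSum f F)
    (hG : ∀ i, HasFormalSum (fun k => f ⟨i, k⟩) (G i)) : HasFormalSum G F := by
  have key : ∀ i d, (G i).coeff d ≠ 0 → ∃ k, (f ⟨i, k⟩).coeff d ≠ 0 := by
    intro i d h
    rw [(hG i).coeff_eq d] at h
    by_contra! h0
    exact h (by simp [h0])
  refine .intro (hf.isPWO.mono ?_) ?_ ?_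
  · rintro d hd
    simp only [Set.mem_iUnion] at hd ⊢
    obtain ⟨i, hd⟩ := hd
    obtain ⟨k, hk⟩ := key i d hd
    exact ⟨⟨i, k⟩, hk⟩
  · intro d
    refine ((hf.finite d).image Sigma.fst).subset fun i hi => ?_
    obtain ⟨k, hk⟩ := key i d hi
    exact ⟨⟨i, k⟩, hk, rfl⟩
  · intro d
    rw [hf.coeff_eq d, finsum_sigma _ (hf.finite d)]
    exact (finsum_congr fun i => (hG i).coeff_eq d).symm

/-! ### Families of power series -/

theorem coeff_ofPowerSeries_of_notMem_range (g : PowerSeries ℚ) {d : ℚ}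
    (hd : ∀ n : ℕ, (n : ℚ) ≠ d) : (HahnSeries.ofPowerSeries ℚ ℚ g).coeff d = 0 := by
  rw [HahnSeries.ofPowerSeries_apply]
  refine HahnSeries.embDomain_of_notMem_range ?_
  rintro ⟨n, hn⟩
  exact hd n hn

/-- A criterion for summability of a family of power series. -/
theorem hasFormalSum_ofPowerSeries {g : ℕ → PowerSeries ℚ} {G : PowerSeries ℚ}
    (hg : ∀ k, PowerSeries.X ^ k ∣ g k)
    (hG : ∀ n, ∑ k ∈ Finset.range (n + 1), PowerSeries.coeff n (g k) = PowerSeries.coeff n G) :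
    HasFormalSum (fun k => HahnSeries.ofPowerSeries ℚ ℚ (g k))
      (HahnSeries.ofPowerSeries ℚ ℚ G) := by
  have hz : ∀ n k, n < k → PowerSeries.coeff n (g k) = 0 := fun n k h =>
    PowerSeries.X_pow_dvd_iff.1 (hg k) n h
  refine .intro ?_ ?_ ?_
  · have hN : (Set.range fun n : ℕ => (n : ℚ)).IsPWO := by
      rw [← Set.image_univ]
      exact (Set.isPWO_of_wellQuasiOrderedLE _).image_of_monotone Nat.mono_cast
    refine hN.mono (Set.iUnion_subset fun k x hx => ?_)
    by_contra h
    exact hx (coeff_ofPowerSeries_of_notMem_range _ fun n hn => h ⟨n, hn⟩)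
  · intro d
    by_cases hd : ∃ n : ℕ, (n : ℚ) = d
    · obtain ⟨n, rfl⟩ := hd
      refine (Finset.range (n + 1)).finite_toSet.subset fun k hk => ?_
      simp only [HahnSeries.ofPowerSeries_apply_coeff, Set.mem_ofPred_eq] at hk
      by_contra h
      exact hk (hz n k (by simpa [Nat.lt_succ_iff] using h))
    · push Not at hd
      simp [coeff_ofPowerSeries_of_notMem_range _ hd]
  · intro d
    by_cases hd : ∃ n : ℕ, (n : ℚ) = d
    · obtain ⟨n, rfl⟩ := hd
      simp only [HahnSeries.ofPowerSeries_apply_coeff]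
      rw [← hG, finsum_eq_sum_of_support_subset]
      intro k hk
      by_contra h
      exact hk (hz n k (by simpa [Nat.lt_succ_iff] using h))
    · push Not at hd
      simp [coeff_ofPowerSeries_of_notMem_range _ hd]

/-! ### Gaussian binomial coefficients -/

theorem qpow_mul_qpow (x y : ℚ) : qpow x * qpow y = qpow (x + y) := by
  simp [qpow, HahnSeries.single_mul_single]

@[simp] theorem qpow_zero : qpow 0 = 1 := rfl

theorem qpow_eq_mul {x y z : ℚ} (h : x = y + z) : qpow x = qpow y * qpow z := by
  rw [qpow_mul_qpow, h]

theorem ofPowerSeries_X_pow_eq_qpow (n : ℕ) :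
    HahnSeries.ofPowerSeries ℚ ℚ (PowerSeries.X ^ n) = qpow n :=
  HahnSeries.ofPowerSeries_X_pow n

theorem one_sub_qpow_ne_zero {x : ℚ} (hx : x ≠ 0) : 1 - qpow x ≠ 0 := by
  rw [sub_ne_zero]
  intro h
  have := congrArg (fun F : QSeries => F.coeff 0) h
  simp [qpow, HahnSeries.coeff_single_of_ne hx.symm] at this

theorem qPoch_zero : qPoch 0 = 1 := by simp [qPoch]

theorem qPoch_succ (m : ℕ) : qPoch (m + 1) = qPoch m * (1 - qpow ((m : ℚ) + 1)) :=
  Finset.prod_range_succ _ _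

theorem qPoch_ne_zero (m : ℕ) : qPoch m ≠ 0 :=
  Finset.prod_ne_zero_iff.2 fun i _ => one_sub_qpow_ne_zero (by positivity)

theorem invQPoch_natCast (m : ℕ) : invQPoch m = (qPoch m)⁻¹ := by
  simp [invQPoch]

theorem invQPoch_of_neg {m : ℤ} (h : m < 0) : invQPoch m = 0 := if_pos h

/-- Valid for every integer: at `m = 0` the factor `1 - q^0` vanishes, as does `1 / (q)_{-1}`. This
lets the Pascal rules be proved without boundary cases. -/
theorem one_sub_qpow_mul_invQPoch (m : ℤ) :
    (1 - qpow m) * invQPoch m = invQPoch (m - 1) := by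
  rcases lt_trichotomy m 0 with h | rfl | h
  · rw [invQPoch_of_neg h, invQPoch_of_neg (by omega), mul_zero]
  · rw [invQPoch_of_neg (m := 0 - 1) (by omega)]
    simp
  · obtain ⟨k, rfl⟩ : ∃ k : ℕ, m = (k : ℤ) + 1 := ⟨(m - 1).toNat, by omega⟩
    have h1 : ((k : ℤ) + 1) = ((k + 1 : ℕ) : ℤ) := by push_cast; ring
    rw [add_sub_cancel_right, invQPoch_natCast, h1, invQPoch_natCast, qPoch_succ, mul_inv]
    push_cast
    rw [mul_left_comm, mul_inv_cancel₀ (one_sub_qpow_ne_zero (by positivity)), mul_one]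

theorem gaussBinom_intCast (L : ℕ) (k : ℤ) :
    gaussBinom L k = qPoch L * invQPoch k * invQPoch (L - k) := by
  simp [gaussBinom]

theorem gaussBinom_of_ne_intCast {L : ℕ} {x : ℚ} (h : ∀ k : ℤ, x ≠ k) : gaussBinom L x = 0 :=
  if_neg (h _)

theorem gaussBinom_eq_zero {L : ℕ} {x : ℚ} (h : x < 0 ∨ (L : ℚ) < x) : gaussBinom L x = 0 := by
  by_cases hx : ∃ k : ℤ, x = k
  · obtain ⟨k, rfl⟩ := hx
    rw [gaussBinom_intCast]
    rcases h with h | h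
    · rw [invQPoch_of_neg (m := k) (by exact_mod_cast h)]
      simp
    · rw [invQPoch_of_neg (m := (L : ℤ) - k), mul_zero]
      have : (L : ℤ) < k := by exact_mod_cast h
      omega
  · push Not at hx
    exact gaussBinom_of_ne_intCast hx

theorem gaussBinom_symm (L : ℕ) (x : ℚ) : gaussBinom L (L - x) = gaussBinom L x := by
  by_cases hx : ∃ k : ℤ, x = k
  · obtain ⟨k, rfl⟩ := hx
    have : (L : ℚ) - k = ((L - k : ℤ) : ℚ) := by push_cast; ring
    rw [this, gaussBinom_intCast, gaussBinom_intCast, sub_sub_cancel]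
    ring
  · push Not at hx
    rw [gaussBinom_of_ne_intCast hx, gaussBinom_of_ne_intCast]
    intro k hk
    refine hx (L - k) ?_
    push_cast
    linarith

theorem gaussBinom_zero_left (x : ℚ) : gaussBinom 0 x = if x = 0 then 1 else 0 := by
  split_ifs with h
  · subst h
    have := gaussBinom_intCast 0 0
    simpa [qPoch_zero, invQPoch] using this
  · exact gaussBinom_eq_zero (by simpa using lt_or_gt_of_ne h)

/-- Comes from `1 - q^(L+1) = (1 - q^x) + q^x (1 - q^(L+1-x))`. The companion rule
`gaussBinom_succ'` is its mirror image under `x ↦ L + 1 - x`. -/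
theorem gaussBinom_succ (L : ℕ) (x : ℚ) :
    gaussBinom (L + 1) x = gaussBinom L (x - 1) + qpow x * gaussBinom L x := by
  by_cases hx : ∃ k : ℤ, x = k
  · obtain ⟨k, rfl⟩ := hx
    have h1 : (k : ℚ) - 1 = ((k - 1 : ℤ) : ℚ) := by push_cast; ring
    have h2 : (L : ℤ) - (k - 1) = ((L + 1 : ℕ) : ℤ) - k := by push_cast; ring
    have h3 : (L : ℤ) - k = ((L + 1 : ℕ) : ℤ) - k - 1 := by push_cast; ring
    rw [h1, gaussBinom_intCast, gaussBinom_intCast, gaussBinom_intCast, h2, h3,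
      ← one_sub_qpow_mul_invQPoch k, ← one_sub_qpow_mul_invQPoch (((L + 1 : ℕ) : ℤ) - k),
      qPoch_succ]
    have h4 : qpow ((L : ℚ) + 1) = qpow k * qpow ((((L + 1 : ℕ) : ℤ) - k : ℤ) : ℚ) :=
      qpow_eq_mul (by push_cast; ring)
    rw [h4]
    ring
  · push Not at hx
    rw [gaussBinom_of_ne_intCast hx, gaussBinom_of_ne_intCast hx, gaussBinom_of_ne_intCast]
    · simp
    · intro k hk
      refine hx (k + 1) ?_
      push_cast
      linarith

theorem gaussBinom_succ' (L : ℕ) (x : ℚ) :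
    gaussBinom (L + 1) x =
      qpow ((L : ℚ) + 1 - x) * gaussBinom L (x - 1) + gaussBinom L x := by
  have h1 : ((L + 1 : ℕ) : ℚ) - x - 1 = L - x := by push_cast; ring
  have h2 : ((L + 1 : ℕ) : ℚ) - x = L - (x - 1) := by push_cast; ring
  rw [← gaussBinom_symm, gaussBinom_succ, h1, h2, gaussBinom_symm, gaussBinom_symm, add_comm]
  congr 3
  ring

/-! ### Expansions of `1 / (q)_L` and `1 / (q)_∞` -/

theorem hasFormalSum_geometric (c : ℕ) :
    HasFormalSum (fun k : ℕ => qpow (((c : ℚ) + 1) * k)) (1 - qpow ((c : ℚ) + 1))⁻¹ := by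
  have h1 : 0 < (qpow ((c : ℚ) + 1)).orderTop := by
    rw [qpow, HahnSeries.orderTop_single one_ne_zero]
    exact_mod_cast Nat.succ_pos c
  refine ⟨HahnSeries.SummableFamily.powers (qpow ((c : ℚ) + 1)), fun k => ?_, ?_⟩
  · rw [HahnSeries.SummableFamily.powers_of_orderTop_pos h1]
    induction k with
    | zero => simp
    | succ k ih =>
      rw [pow_succ, ih, qpow_mul_qpow]
      push_cast
      congr 1
      ring
  · exact eq_inv_of_mul_eq_one_right (HahnSeries.SummableFamily.one_sub_self_mul_hsum_powers h1)

/-- A product of geometric series. It is kept as a sum over tuples because the tuples will be the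
gap excesses of a monomial of length `L`. -/
theorem hasFormalSum_inv_qPoch (L : ℕ) :
    HasFormalSum (fun k : Fin L → ℕ => qpow (∑ i : Fin L, ((i : ℚ) + 1) * k i)) (qPoch L)⁻¹ := by
  induction L with
  | zero =>
    have := HasFormalSum.of_fintype fun _ : Fin 0 → ℕ => (1 : QSeries)
    simpa [qPoch_zero] using this
  | succ L ih =>
    have h := ((hasFormalSum_geometric L).mul ih).comp_equiv
      (Fin.snocEquiv (fun _ : Fin (L + 1) => ℕ)).symm
    refine h.congr (fun k => ?_) (by rw [qPoch_succ, mul_inv, mul_comm])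
    rw [qpow_mul_qpow, Fin.sum_univ_castSucc, add_comm]
    rfl

theorem nonnegCoeff_inv_qPoch (L : ℕ) : NonnegCoeff (qPoch L)⁻¹ :=
  (hasFormalSum_inv_qPoch L).nonnegCoeff fun _ => nonnegCoeff_qpow _

theorem nonnegCoeff_invQPoch (m : ℤ) : NonnegCoeff (invQPoch m) := by
  rw [invQPoch]
  split_ifs
  · exact nonnegCoeff_zero
  · exact nonnegCoeff_inv_qPoch _

/-- The product is `1 / ((q)_x (q)_{L-x})` or `0`, so positivity of the Gaussian polynomial itself
is not needed. -/
theorem nonnegCoeff_inv_qPoch_mul_gaussBinom (L : ℕ) (x : ℚ) :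
    NonnegCoeff ((qPoch L)⁻¹ * gaussBinom L x) := by
  by_cases hx : ∃ k : ℤ, x = k
  · obtain ⟨k, rfl⟩ := hx
    rw [gaussBinom_intCast, mul_assoc, inv_mul_cancel_left₀ (qPoch_ne_zero L)]
    exact (nonnegCoeff_invQPoch _).mul (nonnegCoeff_invQPoch _)
  · push Not at hx
    rw [gaussBinom_of_ne_intCast hx, mul_zero]
    exact nonnegCoeff_zero

/-- A finite form of the Durfee rectangle identity. -/
theorem sum_gaussBinom_mul_inv_qPoch (M d : ℕ) :
    ∑ k ∈ Finset.range (M + 1),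
      qpow ((k : ℚ) * (k + d)) * gaussBinom M k * (qPoch (k + d))⁻¹ = (qPoch (M + d))⁻¹ := by
  induction M generalizing d with
  | zero => simp [gaussBinom_zero_left]
  | succ M ih =>
    have h1 : ∀ k : ℕ, qpow ((k : ℚ) * (k + d)) * gaussBinom (M + 1) k * (qPoch (k + d))⁻¹ =
        qpow ((k : ℚ) * (k + d)) * qpow ((M : ℚ) + 1 - k) * gaussBinom M (k - 1) *
          (qPoch (k + d))⁻¹ + qpow ((k : ℚ) * (k + d)) * gaussBinom M k * (qPoch (k + d))⁻¹ := by
      intro k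
      rw [gaussBinom_succ']
      ring
    -- After `k ↦ k + 1` the first Pascal term becomes `q^(M+d+1)` times the sum for `d + 1`, which
    -- is why `d` is generalized. With `N = M + d + 1` the goal is then `q^N / (q)_N + 1 / (q)_{N-1}
    -- = 1 / (q)_N`.
    have h2 : ∀ k : ℕ, qpow (((k + 1 : ℕ) : ℚ) * ((k + 1 : ℕ) + d)) *
        qpow ((M : ℚ) + 1 - (k + 1 : ℕ)) * gaussBinom M ((k + 1 : ℕ) - 1) *
          (qPoch (k + 1 + d))⁻¹ = qpow ((M + d : ℕ) + 1) *
        (qpow ((k : ℚ) * (k + (d + 1 : ℕ))) * gaussBinom M k * (qPoch (k + (d + 1)))⁻¹) := by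
      intro k
      rw [qpow_mul_qpow, ← mul_assoc, ← mul_assoc, qpow_mul_qpow, Nat.add_right_comm k 1 d,
        Nat.add_assoc k d 1]
      push_cast
      congr 3
      · ring
      · ring
    rw [Finset.sum_congr rfl fun k _ => h1 k, Finset.sum_add_distrib, Finset.sum_range_succ',
      Finset.sum_congr rfl fun k _ => h2 k, ← Finset.mul_sum, ih (d + 1),
      Finset.sum_range_succ _ (M + 1), ih d,
      gaussBinom_eq_zero (L := M) (x := ((0 : ℕ) : ℚ) - 1) (by left; norm_num),
      gaussBinom_eq_zero (L := M) (x := ((M + 1 : ℕ) : ℚ)) (by right; push_cast; linarith),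
      Nat.add_right_comm M 1 d, ← Nat.add_assoc M d 1, qPoch_succ]
    have := one_sub_qpow_ne_zero (x := ((M + d : ℕ) : ℚ) + 1) (by positivity)
    have := qPoch_ne_zero (M + d)
    field_simp
    ring

/-! ### X-adic limit of `(q)_m` and the Durfee rectangle identity -/

/-- `(q)_m` as a power series. -/
noncomputable def qPochSeries (m : ℕ) : PowerSeries ℚ :=
  ∏ i ∈ Finset.range m, (1 - PowerSeries.X ^ (i + 1))

open scoped PowerSeries.WithPiTopology in
/-- `(q)_∞` as a power series. -/
noncomputable def qPochInfSeries : PowerSeries ℚ :=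
  ∏' i : ℕ, (1 - (PowerSeries.X : PowerSeries ℚ) ^ (i + 1))

theorem ofPowerSeries_qPochSeries (m : ℕ) :
    HahnSeries.ofPowerSeries ℚ ℚ (qPochSeries m) = qPoch m := by
  rw [qPochSeries, map_prod, qPoch]
  refine Finset.prod_congr rfl fun i _ => ?_
  rw [map_sub, map_one, ofPowerSeries_X_pow_eq_qpow]
  push_cast
  rfl

theorem X_pow_dvd_qPochSeries_sub {m n : ℕ} (h : m ≤ n) :
    PowerSeries.X ^ (m + 1) ∣ qPochSeries n - qPochSeries m := by
  induction n, h using Nat.le_induction with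
  | base => simp
  | succ n h ih =>
    have : qPochSeries (n + 1) - qPochSeries m = (qPochSeries n - qPochSeries m) -
        PowerSeries.X ^ (n + 1) * qPochSeries n := by
      rw [qPochSeries, Finset.prod_range_succ, ← qPochSeries]
      ring
    rw [this]
    exact dvd_sub ih ((pow_dvd_pow _ (by omega)).mul_right _)

open scoped PowerSeries.WithPiTopology in
theorem X_pow_dvd_qPochInfSeries_sub (m : ℕ) :
    PowerSeries.X ^ (m + 1) ∣ qPochInfSeries - qPochSeries m := by
  rw [PowerSeries.X_pow_dvd_iff]
  intro d hd
  have h1 := (PowerSeries.WithPiTopology.multipliable_one_sub_X_pow ℚ).hasProd.tendsto_prod_nat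
  have h2 := ((PowerSeries.WithPiTopology.continuous_coeff ℚ d).tendsto _).comp h1
  have h3 : Filter.Tendsto (fun n => PowerSeries.coeff d (qPochSeries n)) Filter.atTop
      (nhds (PowerSeries.coeff d (qPochSeries m))) := by
    refine tendsto_const_nhds.congr' ?_
    filter_upwards [Filter.eventually_ge_atTop m] with n hn
    have := PowerSeries.X_pow_dvd_iff.1 (X_pow_dvd_qPochSeries_sub hn) d hd
    rw [map_sub, sub_eq_zero] at this
    exact this.symm
  rw [map_sub, sub_eq_zero]
  exact tendsto_nhds_unique h2 h3

theorem constantCoeff_qPochSeries (m : ℕ) :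
    PowerSeries.constantCoeff (qPochSeries m) = 1 := by
  simp [qPochSeries, map_prod]

theorem constantCoeff_qPochInfSeries : PowerSeries.constantCoeff qPochInfSeries = 1 := by
  have h := PowerSeries.X_pow_dvd_iff.1 (X_pow_dvd_qPochInfSeries_sub 0) 0 (by norm_num)
  rw [map_sub, sub_eq_zero, PowerSeries.coeff_zero_eq_constantCoeff_apply,
    PowerSeries.coeff_zero_eq_constantCoeff_apply, constantCoeff_qPochSeries] at h
  exact h

theorem ofPowerSeries_inv {f : PowerSeries ℚ} (hf : PowerSeries.constantCoeff f ≠ 0) :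
    HahnSeries.ofPowerSeries ℚ ℚ f⁻¹ = (HahnSeries.ofPowerSeries ℚ ℚ f)⁻¹ :=
  eq_inv_of_mul_eq_one_right (by rw [← map_mul, PowerSeries.mul_inv_cancel _ hf, map_one])

theorem ofPowerSeries_qPochSeries_inv (m : ℕ) :
    HahnSeries.ofPowerSeries ℚ ℚ (qPochSeries m)⁻¹ = (qPoch m)⁻¹ := by
  rw [ofPowerSeries_inv (by simp [constantCoeff_qPochSeries]), ofPowerSeries_qPochSeries]

theorem ofPowerSeries_qPochInfSeries_inv :
    HahnSeries.ofPowerSeries ℚ ℚ qPochInfSeries⁻¹ = qPochInf⁻¹ :=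
  ofPowerSeries_inv (by simp [constantCoeff_qPochInfSeries])

theorem dvd_inv_sub_inv {f g h : PowerSeries ℚ} (hf : PowerSeries.constantCoeff f ≠ 0)
    (hg : PowerSeries.constantCoeff g ≠ 0) (hfg : h ∣ f - g) : h ∣ f⁻¹ - g⁻¹ := by
  have : f⁻¹ - g⁻¹ = (f - g) * (-(f⁻¹ * g⁻¹)) := by
    linear_combination g⁻¹ * PowerSeries.mul_inv_cancel f hf -
      f⁻¹ * PowerSeries.mul_inv_cancel g hg
  rw [this]
  exact hfg.mul_right _

theorem qPochSeries_sum (M d : ℕ) :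
    ∑ k ∈ Finset.range (M + 1), PowerSeries.X ^ (k * (k + d)) *
      (qPochSeries M * (qPochSeries k)⁻¹ * (qPochSeries (M - k))⁻¹) * (qPochSeries (k + d))⁻¹ =
      (qPochSeries (M + d))⁻¹ := by
  apply HahnSeries.ofPowerSeries_injective (Γ := ℚ)
  rw [ofPowerSeries_qPochSeries_inv, ← sum_gaussBinom_mul_inv_qPoch, map_sum]
  refine Finset.sum_congr rfl fun k hk => ?_
  have hk : k ≤ M := by simpa [Nat.lt_succ_iff] using hk
  have := gaussBinom_intCast M k
  rw [← Nat.cast_sub hk, invQPoch_natCast, invQPoch_natCast] at this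
  simp only [map_mul, ofPowerSeries_qPochSeries_inv, ofPowerSeries_qPochSeries,
    ofPowerSeries_X_pow_eq_qpow]
  push_cast at this ⊢
  rw [this]

/-- The limit `M → ∞` of the finite identity, read off coefficient by coefficient. -/
theorem hasFormalSum_durfee (d : ℕ) :
    HasFormalSum (fun k : ℕ => qpow ((k : ℚ) * (k + d)) * (qPoch k)⁻¹ * (qPoch (k + d))⁻¹)
      qPochInf⁻¹ := by
  have hc : ∀ m, PowerSeries.constantCoeff (qPochSeries m) ≠ 0 := fun m => by
    simp [constantCoeff_qPochSeries]
  rw [← ofPowerSeries_qPochInfSeries_inv]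
  refine (hasFormalSum_ofPowerSeries (g := fun k => PowerSeries.X ^ (k * (k + d)) *
    (qPochSeries k)⁻¹ * (qPochSeries (k + d))⁻¹) ?_ ?_).congr (fun k => ?_) rfl
  · intro k
    refine Dvd.dvd.mul_right (Dvd.dvd.mul_right (pow_dvd_pow _ ?_) _) _
    rcases Nat.eq_zero_or_pos k with rfl | hk
    · simp
    · exact Nat.le_mul_of_pos_right k (by omega)
  · intro n
    -- For the coefficient of degree `n`, `M = 2 n` suffices: if `k ≤ n` then `(q)_{2n}` and
    -- `(q)_{2n-k}` agree through degree `n`, and if `k > n` the factor `X^(k(k+d))` has too high a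
    -- degree.
    have h1 : PowerSeries.coeff n (qPochInfSeries⁻¹) =
        PowerSeries.coeff n (qPochSeries (2 * n + d))⁻¹ := by
      rw [← sub_eq_zero, ← map_sub]
      exact PowerSeries.X_pow_dvd_iff.1 (dvd_inv_sub_inv (by simp [constantCoeff_qPochInfSeries])
        (hc _) (X_pow_dvd_qPochInfSeries_sub _)) n (by omega)
    rw [h1, ← qPochSeries_sum, map_sum]
    have h2 : ∀ k ∈ Finset.range (n + 1), PowerSeries.coeff n (PowerSeries.X ^ (k * (k + d)) *
        (qPochSeries k)⁻¹ * (qPochSeries (k + d))⁻¹) =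
        PowerSeries.coeff n (PowerSeries.X ^ (k * (k + d)) *
          (qPochSeries (2 * n) * (qPochSeries k)⁻¹ * (qPochSeries (2 * n - k))⁻¹) *
            (qPochSeries (k + d))⁻¹) := by
      intro k hk
      have hk : k ≤ n := by simpa [Nat.lt_succ_iff] using hk
      rw [eq_comm, ← sub_eq_zero, ← map_sub]
      have h3 : PowerSeries.X ^ (k * (k + d)) *
          (qPochSeries (2 * n) * (qPochSeries k)⁻¹ * (qPochSeries (2 * n - k))⁻¹) *
            (qPochSeries (k + d))⁻¹ - PowerSeries.X ^ (k * (k + d)) *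
        (qPochSeries k)⁻¹ * (qPochSeries (k + d))⁻¹ =
        (qPochSeries (2 * n) - qPochSeries (2 * n - k)) * (PowerSeries.X ^ (k * (k + d)) *
          (qPochSeries k)⁻¹ * (qPochSeries (2 * n - k))⁻¹ * (qPochSeries (k + d))⁻¹) := by
        linear_combination (PowerSeries.X ^ (k * (k + d)) *
          (qPochSeries k)⁻¹ * (qPochSeries (k + d))⁻¹) *
            PowerSeries.mul_inv_cancel (qPochSeries (2 * n - k)) (hc _)
      have h4 : PowerSeries.X ^ (2 * n - k + 1) ∣ qPochSeries (2 * n) - qPochSeries (2 * n - k) :=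
        X_pow_dvd_qPochSeries_sub (by omega)
      rw [h3]
      exact PowerSeries.X_pow_dvd_iff.1 (h4.mul_right _) n (by omega)
    rw [Finset.sum_congr rfl h2]
    refine Finset.sum_subset (Finset.range_mono (by omega)) fun k _ hk => ?_
    have hk : n < k := by simpa [Nat.lt_succ_iff] using hk
    rw [mul_assoc]
    refine PowerSeries.X_pow_dvd_iff.1 (dvd_mul_right (PowerSeries.X ^ (k * (k + d))) _) n ?_
    exact hk.trans_le (Nat.le_mul_of_pos_right k (by omega))
  · simp only [map_mul, ofPowerSeries_qPochSeries_inv, ofPowerSeries_X_pow_eq_qpow]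
    push_cast
    rfl

/-- The sum over all lengths of the binomials with fixed defect `d`. -/
theorem hasFormalSum_gaussBinom (d : ℤ) :
    HasFormalSum (fun L : ℕ => qpow (((L : ℚ) ^ 2 - d ^ 2) / 4) * (qPoch L)⁻¹ *
      gaussBinom L (((L : ℚ) + d) / 2)) qPochInf⁻¹ := by
  wlog hd : 0 ≤ d generalizing d
  · refine (this (-d) (by omega)).congr (fun L => ?_) rfl
    rw [← gaussBinom_symm]
    push_cast
    rw [neg_sq]
    congr 2
    ring
  obtain ⟨d, rfl⟩ := Int.eq_ofNat_of_zero_le hd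
  -- The binomial vanishes unless `L = d + 2 k`, and then `[L, k + d] / (q)_L = 1 / ((q)_k
  -- (q)_{k+d})` is a Durfee term.
  refine HasFormalSum.of_injective (φ := fun k : ℕ => 2 * k + d) (fun a b h => by
    simp only at h; omega) ((hasFormalSum_durfee d).congr (fun k => ?_) rfl) fun L hL => ?_
  · have h1 : (((2 * k + d : ℕ) : ℚ) + ((d : ℤ) : ℚ)) / 2 = ((k + d : ℕ) : ℤ) := by
      push_cast
      ring
    have h2 : ((2 * k + d : ℕ) : ℤ) - ((k + d : ℕ) : ℤ) = (k : ℕ) := by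
      push_cast
      ring
    have h3 : (((2 * k + d : ℕ) : ℚ) ^ 2 - ((d : ℤ) : ℚ) ^ 2) / 4 = (k : ℚ) * (k + d) := by
      push_cast
      ring
    rw [h1, gaussBinom_intCast, h2, h3, invQPoch_natCast, invQPoch_natCast]
    have := qPoch_ne_zero (2 * k + d)
    field_simp
  · rw [mul_eq_zero]
    right
    by_cases hx : ∃ m : ℤ, ((L : ℚ) + (d : ℤ)) / 2 = m
    · obtain ⟨m, hm⟩ := hx
      refine gaussBinom_eq_zero (Or.inr ?_)
      by_contra! h
      rw [hm] at h
      have h4 : (L : ℤ) + d = 2 * m := by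
        have : ((L : ℚ) + (d : ℤ)) = 2 * m := by linarith
        exact_mod_cast this
      have h5 : m ≤ L := by exact_mod_cast h
      exact hL ⟨(L - m).toNat, by simp only; omega⟩
    · push Not at hx
      exact gaussBinom_of_ne_intCast hx

/-! ### Recursion for the configuration sums -/

theorem mem_configs {p L : ℕ} {a c : ℤ} {ρ : Fin (L + 1) → ℤ} :
    ρ ∈ configs p L a c ↔ (∀ i, ρ i ∈ Set.Icc (1 : ℤ) (p - 1)) ∧
      (∀ i : Fin L, ρ i.succ = ρ i.castSucc + 1 ∨ ρ i.succ = ρ i.castSucc - 1) ∧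
      ρ 0 = a ∧ ρ (Fin.last L) = c := by
  simp [configs]

theorem init_mem_configs {p L : ℕ} {a c : ℤ} {ρ : Fin (L + 1 + 1) → ℤ}
    (h : ρ ∈ configs p (L + 1) a c) :
    (Fin.init ρ : Fin (L + 1) → ℤ) ∈ configs p L a (ρ (Fin.last L).castSucc) := by
  rw [mem_configs] at h ⊢
  obtain ⟨h1, h2, h3, -⟩ := h
  exact ⟨fun i => h1 _, fun i => h2 i.castSucc, h3, rfl⟩

theorem snoc_mem_configs {p L : ℕ} {a b c : ℤ} {ρ : Fin (L + 1) → ℤ} (h : ρ ∈ configs p L a b)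
    (hc : c ∈ Set.Icc (1 : ℤ) (p - 1)) (hbc : c = b + 1 ∨ c = b - 1) :
    (Fin.snoc ρ c : Fin (L + 1 + 1) → ℤ) ∈ configs p (L + 1) a c := by
  rw [mem_configs] at h ⊢
  obtain ⟨h1, h2, h3, h4⟩ := h
  refine ⟨fun i => ?_, fun i => ?_, ?_, ?_⟩
  · induction i using Fin.lastCases with
    | last => simpa using hc
    | cast i => simpa using h1 i
  · induction i using Fin.lastCases with
    | last => simpa [h4] using hbc
    | cast i =>
      have := h2 i
      rw [← Fin.castSucc_succ, Fin.snoc_castSucc, Fin.snoc_castSucc]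
      exact this
  · rw [← h3]
    exact Fin.snoc_castSucc (α := fun _ => ℤ) c ρ 0
  · simp

theorem configWeight_succ (p p' L : ℕ) (ρ : Fin (L + 1 + 1 + 1) → ℤ) :
    configWeight p p' (L + 1) ρ = configWeight p p' L (Fin.init ρ) +
      ((L : ℚ) + 1) * weight p p' (ρ (Fin.last L).castSucc.castSucc)
        (ρ (Fin.last (L + 1)).castSucc) (ρ (Fin.last (L + 2))) := by
  rw [configWeight, Fin.sum_univ_castSucc]
  rfl

theorem sum_units (f : ℤˣ → QSeries) : ∑ τ : ℤˣ, f τ = f 1 + f (-1) := by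
  have : (Finset.univ : Finset ℤˣ) = {1, -1} := by decide
  rw [this, Finset.sum_pair (by decide)]

theorem sum_configs_of_penultimate {p L : ℕ} {a c : ℤ} {M : Type*} [AddCommMonoid M]
    (f : (Fin (L + 1 + 1) → ℤ) → M) :
    ∑ ρ ∈ configs p (L + 1) a c, f ρ =
      ∑ ρ ∈ (configs p (L + 1) a c).filter (fun ρ => ρ (Fin.last L).castSucc = c + 1), f ρ +
      ∑ ρ ∈ (configs p (L + 1) a c).filter (fun ρ => ρ (Fin.last L).castSucc = c - 1), f ρ := by
  rw [← Finset.sum_filter_add_sum_filter_not _ fun ρ => ρ (Fin.last L).castSucc = c + 1]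
  congr 2
  refine Finset.filter_congr fun ρ hρ => ?_
  obtain ⟨-, h2, -, h4⟩ := mem_configs.1 hρ
  have h5 : ρ (Fin.last (L + 1)) = ρ (Fin.last L).castSucc + 1 ∨
      ρ (Fin.last (L + 1)) = ρ (Fin.last L).castSucc - 1 := h2 (Fin.last L)
  omega

/-- Supplies the boundary values at `b = 0` and `b = p`, which the alternating sums must reproduce.
-/
theorem configSum_eq_zero {p p' L : ℕ} {a b c : ℤ} (hb : b ∉ Set.Icc (1 : ℤ) (p - 1)) :
    configSum p p' L a b c = 0 := by
  refine Finset.sum_eq_zero fun ρ hρ => ?_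
  obtain ⟨h1, h2⟩ := Finset.mem_filter.1 hρ
  exact absurd (h2 ▸ (mem_configs.1 h1).1 _) hb

theorem configSum_zero {p p' : ℕ} {a b c : ℤ} (ha : a ∈ Set.Icc (1 : ℤ) (p - 1))
    (hc : c ∈ Set.Icc (1 : ℤ) (p - 1)) (hbc : c = b + 1 ∨ c = b - 1) :
    configSum p p' 0 a b c = if b = a then 1 else 0 := by
  split_ifs with h
  · subst h
    have : (configs p (0 + 1) b c).filter (fun ρ => ρ (Fin.last 0).castSucc = b) = {![b, c]} := by
      ext ρ
      rw [Finset.mem_filter, mem_configs, Finset.mem_singleton]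
      constructor
      · rintro ⟨⟨-, -, h1, h2⟩, -⟩
        ext i
        fin_cases i
        · exact h1
        · exact h2
      · rintro rfl
        refine ⟨⟨fun i => ?_, fun i => ?_, rfl, rfl⟩, rfl⟩
        · fin_cases i
          · exact ha
          · exact hc
        · fin_cases i
          exact hbc
    rw [configSum, this, Finset.sum_singleton]
    simp [configWeight]
  · refine Finset.sum_eq_zero fun ρ hρ => ?_
    obtain ⟨h1, h2⟩ := Finset.mem_filter.1 hρ
    obtain ⟨-, -, h3, -⟩ := mem_configs.1 h1
    exact absurd (h2.symm.trans h3) h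

/-- Deleting the last vertex `c` loses only the summand with factor `L + 1`, which depends on the
last three vertices. -/
theorem configSum_succ {p p' L : ℕ} {a b c : ℤ} (hc : c ∈ Set.Icc (1 : ℤ) (p - 1))
    (hbc : c = b + 1 ∨ c = b - 1) :
    configSum p p' (L + 1) a b c =
      qpow (((L : ℚ) + 1) * weight p p' (b + 1) b c) * configSum p p' L a (b + 1) b +
      qpow (((L : ℚ) + 1) * weight p p' (b - 1) b c) * configSum p p' L a (b - 1) b := by
  have h1 : configSum p p' (L + 1) a b c = ∑ ρ ∈ configs p (L + 1) a b,
      qpow (((L : ℚ) + 1) * weight p p' (ρ (Fin.last L).castSucc) b c) *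
        qpow (configWeight p p' L ρ) := by
    refine Finset.sum_nbij' (fun ρ => (Fin.init ρ : Fin (L + 1 + 1) → ℤ))
      (fun ρ => (Fin.snoc ρ c : Fin (L + 1 + 1 + 1) → ℤ)) ?_ ?_ ?_ ?_ ?_
    · intro ρ hρ
      obtain ⟨h1, h2⟩ := Finset.mem_filter.1 hρ
      have := init_mem_configs h1
      rwa [h2] at this
    · intro ρ hρ
      refine Finset.mem_filter.2 ⟨snoc_mem_configs hρ hc hbc, ?_⟩
      rw [Fin.snoc_castSucc]
      exact (mem_configs.1 hρ).2.2.2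
    · intro ρ hρ
      obtain ⟨h1, h2⟩ := Finset.mem_filter.1 hρ
      rw [← (mem_configs.1 h1).2.2.2, Fin.snoc_init_self]
    · intro ρ _
      exact Fin.init_snoc _ _
    · intro ρ hρ
      obtain ⟨h1, h2⟩ := Finset.mem_filter.1 hρ
      rw [qpow_mul_qpow, configWeight_succ, h2, add_comm]
      congr 3
      rw [← (mem_configs.1 h1).2.2.2]
      rfl
  rw [h1, sum_configs_of_penultimate, configSum, configSum, Finset.mul_sum, Finset.mul_sum]
  congr 1 <;>
  · refine Finset.sum_congr rfl fun ρ hρ => ?_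
    rw [(Finset.mem_filter.1 hρ).2]

theorem nonnegCoeff_configSum (p p' L : ℕ) (a b c : ℤ) :
    NonnegCoeff (configSum p p' L a b c) :=
  nonnegCoeff_sum fun _ _ => nonnegCoeff_qpow _

/-! ### Configuration sums on the whole line -/

/-- `q ^ (…) [L, (L + b - a) / 2]`: the configuration sum over sequences on `ℤ` from `a` to `b`
whose last step is `b → b + 1`. -/
noncomputable def freeUp (t : ℚ) (L : ℕ) (a b : ℤ) : QSeries :=
  qpow (t * L * (L + 1) / 4 - ((L : ℚ) - b + a) / 2 * ((⌊t * ((b + 1 : ℤ) : ℚ)⌋ : ℚ) - (b + 1)) -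
      (t - 1) * ((((L : ℚ) - b + a) / 2) ^ 2 - a * (((L : ℚ) - b + a) / 2))) *
    gaussBinom L (((L : ℚ) + b - a) / 2)

/-- The configuration sum over sequences on `ℤ` from `a` to `b` whose last step is
`b → b - 1`. -/
noncomputable def freeDown (t : ℚ) (L : ℕ) (a b : ℤ) : QSeries :=
  qpow (t * L * (L + 1) / 4 + ((L : ℚ) + b - a) / 2 * ((⌊t * ((b - 1 : ℤ) : ℚ)⌋ : ℚ) - (b - 1)) +
      ((L : ℚ) + b - a) / 2 -
      (t - 1) * ((((L : ℚ) + b - a) / 2) ^ 2 + a * (((L : ℚ) + b - a) / 2))) *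
    gaussBinom L (((L : ℚ) + b - a) / 2)

/-- This dichotomy decides which of the two q-Pascal rules applies at `b`. -/
theorem floor_mul_succ {t : ℚ} (h1 : 1 < t) (h2 : t < 2) (b : ℤ) :
    ⌊t * ((b + 1 : ℤ) : ℚ)⌋ = ⌊t * (b : ℚ)⌋ + 1 ∨
      ⌊t * ((b + 1 : ℤ) : ℚ)⌋ = ⌊t * (b : ℚ)⌋ + 2 := by
  have h3 := Int.floor_le (t * (b : ℚ))
  have h4 := Int.lt_floor_add_one (t * (b : ℚ))
  have h5 : ⌊t * (b : ℚ)⌋ + 1 ≤ ⌊t * ((b + 1 : ℤ) : ℚ)⌋ := by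
    rw [Int.le_floor]
    push_cast
    linarith
  have h6 : ⌊t * ((b + 1 : ℤ) : ℚ)⌋ < ⌊t * (b : ℚ)⌋ + 3 := by
    rw [Int.floor_lt]
    push_cast
    linarith
  omega

/-! ### Recursion and reflection symmetry of the free sums -/

theorem weight_up_up (p p' : ℕ) (b : ℤ) :
    weight p p' (b - 1) b (b + 1) = (p' : ℚ) / p / 2 := by
  rw [weight, if_neg (by omega)]

theorem weight_down_down (p p' : ℕ) (b : ℤ) :
    weight p p' (b + 1) b (b - 1) = (p' : ℚ) / p / 2 := by
  rw [weight, if_neg (by omega)]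

theorem weight_down_up (p p' : ℕ) (b : ℤ) :
    weight p p' (b + 1) b (b + 1) = 1 - (p' : ℚ) / p / 2 -
      ⌊(p' : ℚ) / p * ((b + 1 : ℤ) : ℚ)⌋ + (p' : ℚ) / p * ((b + 1 : ℤ) : ℚ) := by
  rw [weight, if_pos rfl, if_neg (by omega)]

theorem weight_up_down (p p' : ℕ) (b : ℤ) :
    weight p p' (b - 1) b (b - 1) = 2 - (p' : ℚ) / p / 2 +
      ⌊(p' : ℚ) / p * ((b - 1 : ℤ) : ℚ)⌋ - (p' : ℚ) / p * ((b - 1 : ℤ) : ℚ) := by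
  rw [weight, if_pos rfl, if_pos (by omega)]

/-- Both terms on the right carry `⌊t b⌋`, while the left side carries `⌊t (b + 1)⌋`. A jump of 1
makes the exponents match `gaussBinom_succ`, a jump of 2 `gaussBinom_succ'`. -/
theorem freeUp_succ {p p' : ℕ} (ht1 : 1 < (p' : ℚ) / p) (ht2 : (p' : ℚ) / p < 2)
    (L : ℕ) (a b : ℤ) :
    freeUp ((p' : ℚ) / p) (L + 1) a b =
      qpow (((L : ℚ) + 1) * weight p p' (b + 1) b (b + 1)) * freeDown ((p' : ℚ) / p) L a (b + 1) +
      qpow (((L : ℚ) + 1) * weight p p' (b - 1) b (b + 1)) * freeUp ((p' : ℚ) / p) L a (b - 1) := by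
  have hk1 : ((L : ℚ) + (b + 1 : ℤ) - a) / 2 = (((L + 1 : ℕ) : ℚ) + b - a) / 2 := by
    push_cast; ring
  have hk2 : ((L : ℚ) + (b - 1 : ℤ) - a) / 2 = (((L + 1 : ℕ) : ℚ) + b - a) / 2 - 1 := by
    push_cast; ring
  have hF := floor_mul_succ ht1 ht2 b
  rw [weight_up_up, weight_down_up, freeUp, freeDown, freeUp, add_sub_cancel_right,
    sub_add_cancel, hk1, hk2]
  generalize (p' : ℚ) / p = t at *
  rcases hF with hF | hF
  · rw [gaussBinom_succ, mul_add, ← mul_assoc, ← mul_assoc, ← mul_assoc, qpow_mul_qpow,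
      qpow_mul_qpow, qpow_mul_qpow, hF, add_comm]
    congr 3 <;> (push_cast; ring)
  · rw [gaussBinom_succ', mul_add, ← mul_assoc, ← mul_assoc, ← mul_assoc, qpow_mul_qpow,
      qpow_mul_qpow, qpow_mul_qpow, hF, add_comm]
    congr 3 <;> (push_cast; ring)

/-- Here the jump is from `⌊t (b - 1)⌋` to `⌊t b⌋`, and the two Pascal rules exchange roles. -/
theorem freeDown_succ {p p' : ℕ} (ht1 : 1 < (p' : ℚ) / p) (ht2 : (p' : ℚ) / p < 2)
    (L : ℕ) (a b : ℤ) :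
    freeDown ((p' : ℚ) / p) (L + 1) a b =
      qpow (((L : ℚ) + 1) * weight p p' (b + 1) b (b - 1)) * freeDown ((p' : ℚ) / p) L a (b + 1) +
      qpow (((L : ℚ) + 1) * weight p p' (b - 1) b (b - 1)) * freeUp ((p' : ℚ) / p) L a (b - 1) := by
  have hk1 : ((L : ℚ) + (b + 1 : ℤ) - a) / 2 = (((L + 1 : ℕ) : ℚ) + b - a) / 2 := by
    push_cast; ring
  have hk2 : ((L : ℚ) + (b - 1 : ℤ) - a) / 2 = (((L + 1 : ℕ) : ℚ) + b - a) / 2 - 1 := by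
    push_cast; ring
  have hF := floor_mul_succ ht1 ht2 (b - 1)
  rw [sub_add_cancel] at hF
  rw [weight_down_down, weight_up_down, freeDown, freeDown, freeUp, add_sub_cancel_right,
    sub_add_cancel, hk1, hk2]
  generalize (p' : ℚ) / p = t at *
  rcases hF with hF | hF
  · rw [gaussBinom_succ', mul_add, ← mul_assoc, ← mul_assoc, ← mul_assoc, qpow_mul_qpow,
      qpow_mul_qpow, qpow_mul_qpow, hF, add_comm]
    congr 3 <;> (push_cast; ring)
  · rw [gaussBinom_succ, mul_add, ← mul_assoc, ← mul_assoc, ← mul_assoc, qpow_mul_qpow,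
      qpow_mul_qpow, qpow_mul_qpow, hF, add_comm]
    congr 3 <;> (push_cast; ring)

/-- Reflection in the wall `0`. Since `⌊t⌋ = 1`, the floor term drops out and the rest of the
exponent is even in `a`; the binomials agree by symmetry. -/
theorem freeUp_neg {p p' : ℕ} (ht1 : 1 < (p' : ℚ) / p) (ht2 : (p' : ℚ) / p < 2)
    (L : ℕ) (a : ℤ) :
    freeUp ((p' : ℚ) / p) L (-a) 0 = freeUp ((p' : ℚ) / p) L a 0 := by
  have hF : ⌊(p' : ℚ) / p * ((0 + 1 : ℤ) : ℚ)⌋ = 1 := by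
    rw [Int.floor_eq_iff]
    push_cast
    constructor <;> linarith
  rw [freeUp, freeUp, hF, ← gaussBinom_symm]
  congr 2 <;> (push_cast; ring)

/-- Reflection in the wall `p`. It uses `t (p - 1) = p' - t`, whose integer part is `p' - 2`. -/
theorem freeDown_two_mul_sub {p p' : ℕ} (ht1 : 1 < (p' : ℚ) / p) (ht2 : (p' : ℚ) / p < 2)
    (L : ℕ) (a : ℤ) :
    freeDown ((p' : ℚ) / p) L (2 * p - a) p = freeDown ((p' : ℚ) / p) L a p := by
  have hp : (p : ℚ) ≠ 0 := by
    rintro h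
    rw [h, div_zero] at ht1
    linarith
  have ht : (p' : ℚ) / p * p = p' := div_mul_cancel₀ _ hp
  have hF : ⌊(p' : ℚ) / p * ((p - 1 : ℤ) : ℚ)⌋ = (p' : ℤ) - 2 := by
    rw [Int.floor_eq_iff]
    push_cast
    constructor <;> linarith
  rw [freeDown, freeDown, hF, ← gaussBinom_symm]
  generalize (p' : ℚ) / p = t at *
  push_cast
  rw [← ht]
  congr 2 <;> ring

/-! ### Bosonic form of the configuration sums -/

theorem finite_gaussBinom_ne_zero (L : ℕ) (y : ℚ) {z : ℚ} (hz : z ≠ 0) :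
    {n : ℤ | gaussBinom L (y + z * n) ≠ 0}.Finite := by
  have hinj : Function.Injective fun n : ℤ => y + z * n := fun m n h => by
    simpa [hz] using h
  refine (((Finset.Icc (0 : ℤ) L).finite_toSet.image (Int.cast : ℤ → ℚ)).preimage
    hinj.injOn).subset fun n hn => ?_
  by_contra h
  refine hn ?_
  by_cases hx : ∃ k : ℤ, y + z * n = k
  · obtain ⟨k, hk⟩ := hx
    refine gaussBinom_eq_zero ?_
    rw [hk]
    by_contra! h'
    refine h ⟨k, ?_, hk.symm⟩
    rw [Finset.coe_Icc, Set.mem_Icc]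
    exact_mod_cast h'
  · push Not at hx
    exact gaussBinom_of_ne_intCast hx

theorem hasFiniteSupport_mul_gaussBinom (L : ℕ) {c : ℤ → QSeries} {x : ℤ → ℚ} (y : ℚ) {z : ℚ}
    (hz : z ≠ 0) (hx : ∀ n, x n = y + z * n) :
    Function.HasFiniteSupport fun n => c n * gaussBinom L (x n) := by
  refine (finite_gaussBinom_ne_zero L y hz).subset fun n hn => ?_
  rw [Set.mem_ofPred_eq, ← hx]
  exact right_ne_zero_of_mul hn

theorem hasFiniteSupport_freeUp {p : ℕ} (hp : p ≠ 0) (t : ℚ) (L : ℕ) (a b : ℤ) :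
    Function.HasFiniteSupport fun n : ℤ => freeUp t L (a + 2 * p * n) b :=
  hasFiniteSupport_mul_gaussBinom L (((L : ℚ) + b - a) / 2) (z := -p) (by simpa)
    fun n => by push_cast; ring

theorem hasFiniteSupport_freeUp_neg {p : ℕ} (hp : p ≠ 0) (t : ℚ) (L : ℕ) (a b : ℤ) :
    Function.HasFiniteSupport fun n : ℤ => freeUp t L (-(a + 2 * p * n)) b :=
  hasFiniteSupport_mul_gaussBinom L (((L : ℚ) + b + a) / 2) (z := p) (by simpa)
    fun n => by push_cast; ring

theorem hasFiniteSupport_freeDown {p : ℕ} (hp : p ≠ 0) (t : ℚ) (L : ℕ) (a b : ℤ) :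
    Function.HasFiniteSupport fun n : ℤ => freeDown t L (a + 2 * p * n) b :=
  hasFiniteSupport_mul_gaussBinom L (((L : ℚ) + b - a) / 2) (z := -p) (by simpa)
    fun n => by push_cast; ring

theorem hasFiniteSupport_freeDown_neg {p : ℕ} (hp : p ≠ 0) (t : ℚ) (L : ℕ) (a b : ℤ) :
    Function.HasFiniteSupport fun n : ℤ => freeDown t L (-(a + 2 * p * n)) b :=
  hasFiniteSupport_mul_gaussBinom L (((L : ℚ) + b + a) / 2) (z := p) (by simpa)
    fun n => by push_cast; ring

/-- The alternating sum of `freeUp` over the images of `a` under reflections in `0` and `p`. -/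
noncomputable def bosonicUp (p p' L : ℕ) (a b : ℤ) : QSeries :=
  ∑ᶠ n : ℤ, (freeUp ((p' : ℚ) / p) L (a + 2 * p * n) b -
    freeUp ((p' : ℚ) / p) L (-(a + 2 * p * n)) b)

/-- The alternating sum of `freeDown` over the images of `a` under reflections in `0` and `p`. -/
noncomputable def bosonicDown (p p' L : ℕ) (a b : ℤ) : QSeries :=
  ∑ᶠ n : ℤ, (freeDown ((p' : ℚ) / p) L (a + 2 * p * n) b -
    freeDown ((p' : ℚ) / p) L (-(a + 2 * p * n)) b)

theorem finsum_linear_combination {f g h : ℤ → QSeries} (x y : QSeries)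
    (hg : Function.HasFiniteSupport g) (hh : Function.HasFiniteSupport h)
    (hf : ∀ n, f n = x * g n + y * h n) : ∑ᶠ n, f n = x * ∑ᶠ n, g n + y * ∑ᶠ n, h n := by
  rw [finsum_congr hf, finsum_add_distrib, mul_finsum, mul_finsum]
  · exact hg.subset fun n hn => right_ne_zero_of_mul hn
  · exact hh.subset fun n hn => right_ne_zero_of_mul hn

theorem ne_zero_of_one_lt_div {p p' : ℕ} (ht1 : 1 < (p' : ℚ) / p) : p ≠ 0 := by
  rintro rfl
  norm_num at ht1

theorem bosonicUp_zero_right {p p' : ℕ} (ht1 : 1 < (p' : ℚ) / p) (ht2 : (p' : ℚ) / p < 2)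
    (L : ℕ) (a : ℤ) : bosonicUp p p' L a 0 = 0 :=
  finsum_eq_zero_of_forall_eq_zero fun n => by rw [freeUp_neg ht1 ht2, sub_self]

theorem bosonicDown_right {p p' : ℕ} (ht1 : 1 < (p' : ℚ) / p) (ht2 : (p' : ℚ) / p < 2)
    (L : ℕ) (a : ℤ) : bosonicDown p p' L a p = 0 := by
  have hp := ne_zero_of_one_lt_div ht1
  rw [bosonicDown, finsum_sub_distrib (hasFiniteSupport_freeDown hp _ _ _ _)
    (hasFiniteSupport_freeDown_neg hp _ _ _ _), sub_eq_zero,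
    ← finsum_comp_equiv (Equiv.addRight (1 : ℤ))]
  refine finsum_congr fun n => ?_
  -- The reflection in `p` sends `-(a + 2 p n)` to `a + 2 p (n + 1)`, whence the shift of the index.
  rw [← freeDown_two_mul_sub ht1 ht2]
  congr 1
  simp only [Equiv.coe_addRight]
  ring

theorem bosonicUp_succ {p p' : ℕ} (ht1 : 1 < (p' : ℚ) / p) (ht2 : (p' : ℚ) / p < 2)
    (L : ℕ) (a b : ℤ) :
    bosonicUp p p' (L + 1) a b =
      qpow (((L : ℚ) + 1) * weight p p' (b + 1) b (b + 1)) * bosonicDown p p' L a (b + 1) +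
      qpow (((L : ℚ) + 1) * weight p p' (b - 1) b (b + 1)) * bosonicUp p p' L a (b - 1) := by
  have hp := ne_zero_of_one_lt_div ht1
  refine finsum_linear_combination _ _
    ((hasFiniteSupport_freeDown hp _ _ _ _).sub (hasFiniteSupport_freeDown_neg hp _ _ _ _))
    ((hasFiniteSupport_freeUp hp _ _ _ _).sub (hasFiniteSupport_freeUp_neg hp _ _ _ _))
    fun n => ?_
  rw [freeUp_succ ht1 ht2, freeUp_succ ht1 ht2]
  ring

theorem bosonicDown_succ {p p' : ℕ} (ht1 : 1 < (p' : ℚ) / p) (ht2 : (p' : ℚ) / p < 2)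
    (L : ℕ) (a b : ℤ) :
    bosonicDown p p' (L + 1) a b =
      qpow (((L : ℚ) + 1) * weight p p' (b + 1) b (b - 1)) * bosonicDown p p' L a (b + 1) +
      qpow (((L : ℚ) + 1) * weight p p' (b - 1) b (b - 1)) * bosonicUp p p' L a (b - 1) := by
  have hp := ne_zero_of_one_lt_div ht1
  refine finsum_linear_combination _ _
    ((hasFiniteSupport_freeDown hp _ _ _ _).sub (hasFiniteSupport_freeDown_neg hp _ _ _ _))
    ((hasFiniteSupport_freeUp hp _ _ _ _).sub (hasFiniteSupport_freeUp_neg hp _ _ _ _))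
    fun n => ?_
  rw [freeDown_succ ht1 ht2, freeDown_succ ht1 ht2]
  ring

theorem freeUp_zero (t : ℚ) (a b : ℤ) : freeUp t 0 a b = if b = a then 1 else 0 := by
  rw [freeUp, gaussBinom_zero_left]
  by_cases h : b = a
  · subst h
    simp
  · rw [if_neg h, if_neg, mul_zero]
    intro h'
    refine h ?_
    have : (b : ℚ) = a := by push_cast at h'; linarith
    exact_mod_cast this

theorem freeDown_zero (t : ℚ) (a b : ℤ) : freeDown t 0 a b = if b = a then 1 else 0 := by
  rw [freeDown, gaussBinom_zero_left]
  by_cases h : b = a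
  · subst h
    simp
  · rw [if_neg h, if_neg, mul_zero]
    intro h'
    refine h ?_
    have : (b : ℚ) = a := by push_cast at h'; linarith
    exact_mod_cast this

/-- The strip lies inside a fundamental domain of the group generated by the two reflections, so
only the trivial image of `a` can meet it. This gives the initial condition at `L = 0`. -/
theorem eq_zero_of_reflection {p : ℕ} {a b n : ℤ} (ha : a ∈ Set.Icc (1 : ℤ) (p - 1))
    (hb : b ∈ Set.Icc (1 : ℤ) (p - 1)) :
    (b = a + 2 * p * n ↔ b = a ∧ n = 0) ∧ b ≠ -(a + 2 * p * n) := by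
  obtain ⟨ha1, ha2⟩ := ha
  obtain ⟨hb1, hb2⟩ := hb
  rcases lt_trichotomy n 0 with hn | rfl | hn
  · have : (p : ℤ) * n ≤ -p := by nlinarith
    rw [mul_assoc]
    refine ⟨⟨fun h => ?_, fun h => ?_⟩, fun h => ?_⟩ <;> omega
  · refine ⟨⟨fun h => ?_, fun h => ?_⟩, fun h => ?_⟩ <;> simp at h ⊢ <;> omega
  · have : (p : ℤ) ≤ p * n := by nlinarith
    rw [mul_assoc]
    refine ⟨⟨fun h => ?_, fun h => ?_⟩, fun h => ?_⟩ <;> omega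

theorem finsum_reflection {p : ℕ} {a b : ℤ} (ha : a ∈ Set.Icc (1 : ℤ) (p - 1))
    (hb : b ∈ Set.Icc (1 : ℤ) (p - 1)) :
    ∑ᶠ n : ℤ, (((if b = a + 2 * p * n then 1 else 0) : QSeries) -
      if b = -(a + 2 * p * n) then 1 else 0) = if b = a then 1 else 0 := by
  rw [finsum_eq_single _ 0]
  · have h := (eq_zero_of_reflection (n := 0) ha hb).2
    rw [mul_zero, add_zero] at h ⊢
    rw [if_neg h, sub_zero]
  · intro n hn
    rw [if_neg fun h => hn ((eq_zero_of_reflection ha hb).1.1 h).2,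
      if_neg (eq_zero_of_reflection ha hb).2, sub_zero]

/-- The ranges include the walls `b = 0` and `b = p`, where both sides vanish. At an interior `b`
the recursion calls on `b + 1` going down and `b - 1` going up, which stay within these ranges. -/
theorem configSum_eq_bosonic {p p' : ℕ} (ht1 : 1 < (p' : ℚ) / p) (ht2 : (p' : ℚ) / p < 2)
    {a : ℤ} (ha : a ∈ Set.Icc (1 : ℤ) (p - 1)) (L : ℕ) :
    (∀ b : ℤ, 0 ≤ b → b + 1 ≤ (p : ℤ) - 1 → configSum p p' L a b (b + 1) = bosonicUp p p' L a b) ∧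
      ∀ b : ℤ, 2 ≤ b → b ≤ p → configSum p p' L a b (b - 1) = bosonicDown p p' L a b := by
  induction L with
  | zero =>
    constructor
    · intro b hb1 hb2
      rcases hb1.eq_or_lt with rfl | hb1
      · rw [bosonicUp_zero_right ht1 ht2, configSum_eq_zero (by simp)]
      · rw [configSum_zero ha ⟨by omega, hb2⟩ (Or.inl rfl), bosonicUp,
          ← finsum_reflection ha ⟨by omega, by omega⟩]
        exact finsum_congr fun n => by rw [freeUp_zero, freeUp_zero]
    · intro b hb1 hb2
      rcases hb2.eq_or_lt with rfl | hb2
      · rw [bosonicDown_right ht1 ht2, configSum_eq_zero (by simp)]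
      · rw [configSum_zero ha ⟨by omega, by omega⟩ (Or.inr rfl), bosonicDown,
          ← finsum_reflection ha ⟨by omega, by omega⟩]
        exact finsum_congr fun n => by rw [freeDown_zero, freeDown_zero]
  | succ L ih =>
    have hdown : ∀ b : ℤ, 1 ≤ b → b ≤ (p : ℤ) - 1 →
        configSum p p' L a (b + 1) b = bosonicDown p p' L a (b + 1) := by
      intro b hb1 hb2
      have := ih.2 (b + 1) (by omega) (by omega)
      rwa [add_sub_cancel_right] at this
    have hup : ∀ b : ℤ, 1 ≤ b → b ≤ (p : ℤ) - 1 →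
        configSum p p' L a (b - 1) b = bosonicUp p p' L a (b - 1) := by
      intro b hb1 hb2
      have := ih.1 (b - 1) (by omega) (by omega)
      rwa [sub_add_cancel] at this
    constructor
    · intro b hb1 hb2
      rcases hb1.eq_or_lt with rfl | hb1
      · rw [bosonicUp_zero_right ht1 ht2, configSum_eq_zero (by simp)]
      · rw [configSum_succ ⟨by omega, hb2⟩ (Or.inl rfl), bosonicUp_succ ht1 ht2,
          hdown b (by omega) (by omega), hup b (by omega) (by omega)]
    · intro b hb1 hb2
      rcases hb2.eq_or_lt with rfl | hb2
      · rw [bosonicDown_right ht1 ht2, configSum_eq_zero (by simp)]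
      · rw [configSum_succ ⟨by omega, by omega⟩ (Or.inr rfl), bosonicDown_succ ht1 ht2,
          hdown b (by omega) (by omega), hup b (by omega) (by omega)]

/-! ### The fermionic sums -/

/-- Minimizing `Δ` means minimizing `|t b - s|`. As `t < 2`, a neighbour of `b` would be closer to
`s` unless `-1 ≤ t b - s < 1`; when that neighbour leaves the strip, the bounds on `s` give the same
estimate. Minimality of `b` enters the proof only here. -/
theorem floor_mul_of_isMinimizer {p p' : ℕ} (ht1 : 1 < (p' : ℚ) / p) (ht2 : (p' : ℚ) / p < 2)
    {s b : ℤ} (hs : s ∈ Set.Icc (1 : ℤ) (p' - 1)) (hb : IsMinimizer p p' s b) :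
    ⌊(p' : ℚ) / p * (b : ℚ)⌋ = s ∨ ⌊(p' : ℚ) / p * (b : ℚ)⌋ = s - 1 := by
  have hp : (p : ℚ) ≠ 0 := by exact_mod_cast ne_zero_of_one_lt_div ht1
  have htp : (p' : ℚ) / p * p = p' := div_mul_cancel₀ _ hp
  obtain ⟨⟨hb1, hb2⟩, hmin⟩ := hb
  have hs1 : (1 : ℚ) ≤ s := by exact_mod_cast hs.1
  have hs2 : (s : ℚ) ≤ p' - 1 := by exact_mod_cast hs.2
  have key : ∀ c ∈ Set.Icc (1 : ℤ) (p - 1),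
      ((p' : ℚ) / p * b - s) ^ 2 ≤ ((p' : ℚ) / p * c - s) ^ 2 := by
    intro c hc
    have h := hmin c hc
    simp only [confDim] at h
    rw [div_le_div_iff_of_pos_right (by linarith)] at h
    nlinarith
  generalize (p' : ℚ) / p = t at *
  have hlt : t * b - s < 1 := by
    by_contra! h
    have h1 : 2 ≤ b := by
      by_contra! h1
      have : (b : ℚ) ≤ 1 := by exact_mod_cast Int.lt_add_one_iff.1 h1
      nlinarith
    have h2 := key (b - 1) ⟨by omega, by omega⟩
    push_cast at h2
    nlinarith
  have hgt : -1 ≤ t * b - s := by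
    by_contra! h
    have h1 : b + 1 ≤ p - 1 := by
      by_contra! h1
      have : (p : ℚ) - 1 ≤ b := by exact_mod_cast (by omega : (p : ℤ) - 1 ≤ b)
      nlinarith
    have h2 := key (b + 1) ⟨by omega, h1⟩
    push_cast at h2
    nlinarith
  have h1 : s - 1 ≤ ⌊t * (b : ℚ)⌋ := by
    rw [Int.le_floor]
    push_cast
    linarith
  have h2 : ⌊t * (b : ℚ)⌋ < s + 1 := by
    rw [Int.floor_lt]
    push_cast
    linarith
  omega

/-- The exponent of the term of `fermionicSum` belonging to an image `a` of `r`. -/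
def freeExponent (t : ℚ) (L : ℚ) (s b a : ℤ) : ℚ :=
  t * ((a : ℚ) ^ 2 - b ^ 2) / 4 + (L ^ 2 + b ^ 2 - a ^ 2) / 4 + (b - a) * (s - b) / 2

theorem confDim_succ_sub {p p' : ℕ} (ht1 : 1 < (p' : ℚ) / p) (s b : ℤ) :
    confDim p p' (b + 1) s - confDim p p' b s = (2 * b + 1) * ((p' : ℚ) / p) / 4 - s / 2 := by
  simp only [confDim]
  generalize (p' : ℚ) / p = t at *
  have : t ≠ 0 := by linarith
  push_cast
  field_simp
  ring

theorem confDim_pred_sub {p p' : ℕ} (ht1 : 1 < (p' : ℚ) / p) (s b : ℤ) :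
    confDim p p' (b - 1) s - confDim p p' b s = s / 2 - (2 * b - 1) * ((p' : ℚ) / p) / 4 := by
  simp only [confDim]
  generalize (p' : ℚ) / p = t at *
  have : t ≠ 0 := by linarith
  push_cast
  field_simp
  ring

/-- The differences of `Δ` act as the weight of one more step. Both free sums contain `⌊t b⌋`: the
value `s` gives one Pascal rule, the value `s - 1` the other, with the same outcome. -/
theorem free_closing_step {p p' : ℕ} (ht1 : 1 < (p' : ℚ) / p)
    {s b : ℤ} (hF : ⌊(p' : ℚ) / p * (b : ℚ)⌋ = s ∨ ⌊(p' : ℚ) / p * (b : ℚ)⌋ = s - 1)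
    (L : ℕ) (a : ℤ) :
    qpow (((L : ℚ) + 1) * (confDim p p' (b + 1) s - confDim p p' b s)) *
        freeDown ((p' : ℚ) / p) L a (b + 1) +
      qpow (((L : ℚ) + 1) * (confDim p p' (b - 1) s - confDim p p' b s)) *
        freeUp ((p' : ℚ) / p) L a (b - 1) =
      qpow (freeExponent ((p' : ℚ) / p) (L + 1) s b a) *
        gaussBinom (L + 1) ((((L : ℚ) + 1) + b - a) / 2) := by
  have hk1 : ((L : ℚ) + (b + 1 : ℤ) - a) / 2 = (((L : ℚ) + 1) + b - a) / 2 := by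
    push_cast; ring
  have hk2 : ((L : ℚ) + (b - 1 : ℤ) - a) / 2 = (((L : ℚ) + 1) + b - a) / 2 - 1 := by
    push_cast; ring
  rw [confDim_succ_sub ht1, confDim_pred_sub ht1, freeDown, freeUp, add_sub_cancel_right,
    sub_add_cancel, hk1, hk2, freeExponent]
  generalize (p' : ℚ) / p = t at *
  rcases hF with hF | hF
  · rw [gaussBinom_succ, mul_add (qpow _), ← mul_assoc (qpow _), ← mul_assoc (qpow _),
      ← mul_assoc (qpow _), qpow_mul_qpow,
      qpow_mul_qpow, qpow_mul_qpow, hF, add_comm]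
    congr 3 <;> (push_cast; ring)
  · rw [gaussBinom_succ', mul_add (qpow _), ← mul_assoc (qpow _), ← mul_assoc (qpow _),
      ← mul_assoc (qpow _), qpow_mul_qpow,
      qpow_mul_qpow, qpow_mul_qpow, hF, add_comm]
    congr 3 <;> (push_cast; ring)

theorem confDim_sub_add {p p' : ℕ} (ht1 : 1 < (p' : ℚ) / p) (L : ℚ) (r s b : ℤ) :
    confDim p p' r s - confDim p p' b s + (L ^ 2 - (r - b) ^ 2) / 4 =
      freeExponent ((p' : ℚ) / p) L s b r := by
  simp only [confDim, freeExponent]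
  generalize (p' : ℚ) / p = t at *
  have : t ≠ 0 := by linarith
  field_simp
  ring

/-- Translated images of `r` produce the exponents `A_n`; reflected images, in
`freeExponent_reflect`, produce `B_n`. -/
theorem freeExponent_translate {p p' : ℕ} (ht1 : 1 < (p' : ℚ) / p) (L : ℚ) (s b r n : ℤ) :
    freeExponent ((p' : ℚ) / p) L s b (r + 2 * p * n) = freeExponent ((p' : ℚ) / p) L s b r +
      ((p * (p' - p) * n ^ 2 + ((p' - p) * r - p * (s - b)) * n : ℤ) : ℚ) := by
  have hp : (p : ℚ) ≠ 0 := by exact_mod_cast ne_zero_of_one_lt_div ht1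
  simp only [freeExponent]
  push_cast
  field_simp
  ring

theorem freeExponent_reflect {p p' : ℕ} (ht1 : 1 < (p' : ℚ) / p) (L : ℚ) (s b r n : ℤ) :
    freeExponent ((p' : ℚ) / p) L s b (-(r + 2 * p * n)) = freeExponent ((p' : ℚ) / p) L s b r +
      ((p * (p' - p) * n ^ 2 + ((p' - p) * r + p * (s - b)) * n + r * (s - b) : ℤ) : ℚ) := by
  have hp : (p : ℚ) ≠ 0 := by exact_mod_cast ne_zero_of_one_lt_div ht1
  simp only [freeExponent]
  push_cast
  field_simp
  ring

/-- The bosonic form of the configuration sums with the last step into `b = b(s)` resummed. -/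
theorem sum_configSum_eq_fermionicSum {p p' : ℕ} (ht1 : 1 < (p' : ℚ) / p)
    (ht2 : (p' : ℚ) / p < 2) {r s b : ℤ} (hr : r ∈ Set.Icc (1 : ℤ) (p - 1))
    (hs : s ∈ Set.Icc (1 : ℤ) (p' - 1)) (hb : IsMinimizer p p' s b) (L : ℕ) :
    ∑ τ : ℤˣ, qpow (((L : ℚ) + 1) * (confDim p p' (b + τ) s - confDim p p' b s)) *
        configSum p p' L r (b + τ) b =
      qpow (confDim p p' r s - confDim p p' b s + (((L : ℚ) + 1) ^ 2 - (r - b) ^ 2) / 4) *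
        fermionicSum p p' r s b (L + 1) := by
  have hp := ne_zero_of_one_lt_div ht1
  have hdown : configSum p p' L r (b + 1) b = bosonicDown p p' L r (b + 1) := by
    have := (configSum_eq_bosonic ht1 ht2 hr L).2 (b + 1) (by have := hb.1.1; omega)
      (by have := hb.1.2; omega)
    rwa [add_sub_cancel_right] at this
  have hup : configSum p p' L r (b - 1) b = bosonicUp p p' L r (b - 1) := by
    have := (configSum_eq_bosonic ht1 ht2 hr L).1 (b - 1) (by have := hb.1.1; omega)
      (by have := hb.1.2; omega)
    rwa [sub_add_cancel] at this
  have hfd : Function.HasFiniteSupport fun n : ℤ =>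
      freeDown ((p' : ℚ) / p) L (r + 2 * p * n) (b + 1) -
        freeDown ((p' : ℚ) / p) L (-(r + 2 * p * n)) (b + 1) :=
    (hasFiniteSupport_freeDown hp _ _ _ _).sub (hasFiniteSupport_freeDown_neg hp _ _ _ _)
  have hfu : Function.HasFiniteSupport fun n : ℤ =>
      freeUp ((p' : ℚ) / p) L (r + 2 * p * n) (b - 1) -
        freeUp ((p' : ℚ) / p) L (-(r + 2 * p * n)) (b - 1) :=
    (hasFiniteSupport_freeUp hp _ _ _ _).sub (hasFiniteSupport_freeUp_neg hp _ _ _ _)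
  rw [sum_units, Units.val_neg, Units.val_one, ← sub_eq_add_neg, hdown, hup, bosonicDown,
    bosonicUp, fermionicSum, ← finsum_linear_combination _ _ hfd hfu (fun n => rfl), mul_finsum]
  refine finsum_congr fun n => ?_
  have hF := floor_mul_of_isMinimizer ht1 ht2 hs hb
  have h1 := free_closing_step ht1 hF L (r + 2 * p * n)
  have h2 := free_closing_step ht1 hF L (-(r + 2 * p * n))
  have h3 : (((L : ℚ) + 1) + b - (r + 2 * p * n : ℤ)) / 2 =
      (((L + 1 : ℕ) : ℚ) - r + b) / 2 - p * n := by
    push_cast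
    ring
  -- For a reflected image the lower index is the complement of the one in `fermionicSum`;
  -- `gaussBinom_symm` reconciles them.
  have h4 : (((L : ℚ) + 1) + b - (-(r + 2 * p * n) : ℤ)) / 2 =
      ((L + 1 : ℕ) : ℚ) - ((((L + 1 : ℕ) : ℚ) - r - b) / 2 - p * n) := by
    push_cast
    ring
  rw [h3, freeExponent_translate ht1, ← qpow_mul_qpow] at h1
  rw [h4, gaussBinom_symm, freeExponent_reflect ht1, ← qpow_mul_qpow] at h2
  rw [confDim_sub_add ht1]
  linear_combination h1 - h2

theorem fermionicSum_zero {p p' : ℕ} {r s b : ℤ} (hr : r ∈ Set.Icc (1 : ℤ) (p - 1))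
    (hb : b ∈ Set.Icc (1 : ℤ) (p - 1)) :
    fermionicSum p p' r s b 0 = if r = b then 1 else 0 := by
  have h1 : ∀ n : ℤ, (((0 : ℕ) : ℚ) - r + b) / 2 - p * n = 0 ↔ b = r + 2 * p * n := by
    intro n
    rw [← @Int.cast_inj ℚ]
    push_cast
    constructor <;> intro h <;> linarith
  have h2 : ∀ n : ℤ, (((0 : ℕ) : ℚ) - r - b) / 2 - p * n = 0 ↔ b = -(r + 2 * p * n) := by
    intro n
    rw [← @Int.cast_inj ℚ]
    push_cast
    constructor <;> intro h <;> linarith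
  simp only [eq_comm (a := r)]
  rw [fermionicSum, ← finsum_reflection hr hb]
  refine finsum_congr fun n => ?_
  obtain ⟨h3, h4⟩ := eq_zero_of_reflection (n := n) hr hb
  simp only [gaussBinom_zero_left, h1, h2, if_neg h4, mul_zero]
  split_ifs with h
  · obtain ⟨-, rfl⟩ := h3.1 h
    simp
  · simp

theorem configSumTerm_eq {p p' : ℕ} (ht1 : 1 < (p' : ℚ) / p)
    (ht2 : (p' : ℚ) / p < 2) {r s b : ℤ} (hr : r ∈ Set.Icc (1 : ℤ) (p - 1))
    (hs : s ∈ Set.Icc (1 : ℤ) (p' - 1)) (hb : IsMinimizer p p' s b) (L : ℕ) :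
    configSumTerm p p' r s b L =
      qpow (confDim p p' r s + ((L : ℚ) ^ 2 - (r - b) ^ 2) / 4) * (qPoch L)⁻¹ *
        fermionicSum p p' r s b L := by
  cases L with
  | zero =>
    rw [configSumTerm, fermionicSum_zero hr hb.1]
    split_ifs with h
    · subst h
      simp [qPoch_zero]
    · rw [mul_zero]
  | succ L =>
    rw [configSumTerm, sum_configSum_eq_fermionicSum ht1 ht2 hr hs hb]
    have : qpow (confDim p p' r s + (((L + 1 : ℕ) : ℚ) ^ 2 - (r - b) ^ 2) / 4) =
        qpow (confDim p p' b s) * qpow (confDim p p' r s - confDim p p' b s +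
          (((L : ℚ) + 1) ^ 2 - (r - b) ^ 2) / 4) := qpow_eq_mul (by push_cast; ring)
    rw [this]
    ring

/-- For positive length the alternating sum is, up to a power of `q`, a sum of configuration sums;
length zero is explicit. -/
theorem nonnegCoeff_fermionicSum {p p' : ℕ} (ht1 : 1 < (p' : ℚ) / p)
    (ht2 : (p' : ℚ) / p < 2) {r s b : ℤ} (hr : r ∈ Set.Icc (1 : ℤ) (p - 1))
    (hs : s ∈ Set.Icc (1 : ℤ) (p' - 1)) (hb : IsMinimizer p p' s b) (L : ℕ) :
    NonnegCoeff (fermionicSum p p' r s b L) := by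
  cases L with
  | zero =>
    rw [fermionicSum_zero hr hb.1]
    split_ifs
    · exact nonnegCoeff_qpow 0
    · exact nonnegCoeff_zero
  | succ L =>
    have h := sum_configSum_eq_fermionicSum ht1 ht2 hr hs hb L
    set x := confDim p p' r s - confDim p p' b s + (((L : ℚ) + 1) ^ 2 - (r - b) ^ 2) / 4
    have h1 : fermionicSum p p' r s b (L + 1) =
        qpow (-x) * (qpow x * fermionicSum p p' r s b (L + 1)) := by
      rw [← mul_assoc, qpow_mul_qpow, neg_add_cancel, qpow_zero, one_mul]
    rw [h1, ← h]
    exact (nonnegCoeff_qpow _).mul (nonnegCoeff_sum fun τ _ =>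
      (nonnegCoeff_qpow _).mul (nonnegCoeff_configSum _ _ _ _ _ _))

/-! ### Summation over the length -/

theorem HasFormalSum.of_hasFiniteSupport {ι : Type*} {f : ι → QSeries}
    (hf : Function.HasFiniteSupport f) : HasFormalSum f (∑ᶠ i, f i) := by
  classical
  refine ⟨HahnSeries.SummableFamily.ofFinsupp (Finsupp.ofSupportFinite f hf), fun i => rfl, ?_⟩
  rw [HahnSeries.SummableFamily.hsum_ofFinsupp, finsum_eq_sum f hf, Finsupp.sum]
  refine Finset.sum_congr ?_ fun _ _ => rfl
  ext i
  simp [Finsupp.ofSupportFinite]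

/-- Interchange of summations for series with nonnegative coefficients. -/
theorem HasFormalSum.comm {ι κ : Type*} {f : ι → κ → QSeries} {G : ι → QSeries}
    {H : κ → QSeries} {F : QSeries} (hf : ∀ i k, NonnegCoeff (f i k))
    (hG : ∀ i, HasFormalSum (f i) (G i)) (hF : HasFormalSum G F)
    (hH : ∀ k, HasFormalSum (fun i => f i k) (H k)) : HasFormalSum H F := by
  have h1 : HasFormalSum (fun x : Σ _ : ι, κ => f x.1 x.2) F :=
    .of_sigma (fun x => hf _ _) hG hF
  have h2 := h1.comp_equiv (((Equiv.sigmaEquivProd κ ι).trans (Equiv.prodComm κ ι)).trans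
    (Equiv.sigmaEquivProd ι κ).symm)
  exact h2.sigma hH

/-- In the `n`-th theta term `1 / (q)_∞` is expanded with defect `d n`. The interchange needs
positivity, so the two theta series are treated separately and subtracted afterwards. -/
theorem hasFormalSum_comm_gaussBinom {N d : ℤ → ℤ} {θ : QSeries}
    (hN : HasFormalSum (fun n => qpow (N n)) θ) {y z : ℚ} (hz : z ≠ 0)
    (hd : ∀ n, (d n : ℚ) = y + z * n) :
    HasFormalSum (fun L : ℕ => ∑ᶠ n : ℤ, qpow (N n + ((L : ℚ) ^ 2 - d n ^ 2) / 4) *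
      (qPoch L)⁻¹ * gaussBinom L (((L : ℚ) + d n) / 2)) (qPochInf⁻¹ * θ) := by
  refine HasFormalSum.comm (fun n L => ?_) (fun n => ?_) (hN.mul_left _) fun L =>
    .of_hasFiniteSupport (hasFiniteSupport_mul_gaussBinom L (((L : ℚ) + y) / 2) (z := z / 2)
      (div_ne_zero hz two_ne_zero) fun n => by rw [hd]; ring)
  · rw [mul_assoc]
    exact (nonnegCoeff_qpow _).mul (nonnegCoeff_inv_qPoch_mul_gaussBinom _ _)
  · refine ((hasFormalSum_gaussBinom (d n)).mul_left (qpow (N n))).congr (fun L => ?_)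
      (mul_comm _ _)
    rw [← qpow_mul_qpow, mul_assoc, mul_assoc, mul_assoc]

/-- The fermionic formula for the character. -/
theorem hasFormalSum_fermionicSum {p p' : ℕ} (ht1 : 1 < (p' : ℚ) / p) {r s : ℤ}
    (hr : r ∈ Set.Icc (1 : ℤ) (p - 1)) (hs : s ∈ Set.Icc (1 : ℤ) (p' - 1)) (b : ℤ) :
    HasFormalSum (fun L : ℕ =>
        qpow (confDim p p' r s + ((L : ℚ) ^ 2 - (r - b) ^ 2) / 4) * (qPoch L)⁻¹ *
          fermionicSum p p' r s b L)
      (character p p' r s) := by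
  have hp := ne_zero_of_one_lt_div ht1
  obtain ⟨hθ1, hθ2⟩ := hasFormalSum_theta hr hs
  -- The defects are chosen so that `(L + d n) / 2` is the lower index in `fermionicSum`; then `-(d
  -- n)² / 4` turns `p p' n²` into `p (p' - p) n²`. This works for any integer `b`.
  have h1 := hasFormalSum_comm_gaussBinom (d := fun n => b - r - 2 * p * n) hθ1
    (y := b - r) (z := -2 * p) (by simpa) fun n => by push_cast; ring
  have h2 := hasFormalSum_comm_gaussBinom (d := fun n => -r - b - 2 * p * n) hθ2
    (y := -r - b) (z := -2 * p) (by simpa) fun n => by push_cast; ring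
  refine ((h1.sub h2).mul_left (qpow (confDim p p' r s))).congr (fun L => ?_) ?_
  · rw [← finsum_sub_distrib, mul_finsum, fermionicSum, mul_finsum]
    · refine finsum_congr fun n => ?_
      rw [mul_sub, mul_sub, ← mul_assoc, ← mul_assoc, ← mul_assoc, ← mul_assoc, ← mul_assoc,
        ← mul_assoc, mul_right_comm _ (qPoch L)⁻¹ (qpow _), mul_right_comm _ (qPoch L)⁻¹ (qpow _),
        qpow_mul_qpow, qpow_mul_qpow, qpow_mul_qpow, qpow_mul_qpow]
      congr 4
      · push_cast; ring
      · push_cast; ring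
      · push_cast; ring
      · push_cast; ring
    · exact hasFiniteSupport_mul_gaussBinom L (((L : ℚ) + (b - r)) / 2) (z := -p) (by simpa)
        fun n => by push_cast; ring
    · exact hasFiniteSupport_mul_gaussBinom L (((L : ℚ) + (-r - b)) / 2) (z := -p) (by simpa)
        fun n => by push_cast; ring
  · rw [character]
    ring

/-! ### Admissible monomials and configurations -/

/-- Solves a recursion that runs backwards from the end; it recovers both the configuration from the
signs and the modes from the gaps. -/
theorem eq_add_sum_filter {A : Type*} [AddCommMonoid A] {L : ℕ} {T : ℕ → A} {c : A}
    {f : Fin L → A} (h0 : ∀ i, L ≤ i → T i = c) (hs : ∀ i : Fin L, T i = T (i + 1) + f i)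
    (i : ℕ) : T i = c + ∑ j ∈ Finset.univ.filter (fun j : Fin L => i ≤ (j : ℕ)), f j := by
  induction h : L - i generalizing i with
  | zero =>
    rw [h0 i (by omega), Finset.sum_eq_zero, add_zero]
    intro j hj
    have := (Finset.mem_filter.1 hj).2
    omega
  | succ n ih =>
    have hi : i < L := by omega
    have hins : (Finset.univ.filter fun j : Fin L => i ≤ (j : ℕ)) =
        insert ⟨i, hi⟩ (Finset.univ.filter fun j : Fin L => i + 1 ≤ (j : ℕ)) := by
      ext j
      simp only [Finset.mem_filter, Finset.mem_univ, true_and, Finset.mem_insert, Fin.ext_iff]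
      omega
    rw [hs ⟨i, hi⟩, ih (i + 1) (by omega), hins, Finset.sum_insert (by simp)]
    abel

theorem sum_filter_le_eq {A : Type*} [AddCommMonoid A] {L : ℕ} (f : Fin L → A) (i : Fin L) :
    ∑ j ∈ Finset.univ.filter (fun j : Fin L => (i : ℕ) ≤ (j : ℕ)), f j =
      ∑ j ∈ Finset.univ.filter (fun j : Fin L => (i : ℕ) + 1 ≤ (j : ℕ)), f j + f i := by
  have hins : (Finset.univ.filter fun j : Fin L => (i : ℕ) ≤ j) =
      insert i (Finset.univ.filter fun j : Fin L => (i : ℕ) + 1 ≤ j) := by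
    ext j
    simp only [Finset.mem_filter, Finset.mem_univ, true_and, Finset.mem_insert, Fin.ext_iff]
    omega
  rw [hins, Finset.sum_insert (by simp), add_comm]

theorem sum_filter_le_of_le {A : Type*} [AddCommMonoid A] {L : ℕ} (f : Fin L → A) {i : ℕ}
    (hi : L ≤ i) : ∑ j ∈ Finset.univ.filter (fun j : Fin L => i ≤ (j : ℕ)), f j = 0 := by
  refine Finset.sum_eq_zero fun j hj => ?_
  have := (Finset.mem_filter.1 hj).2
  omega

theorem Monomial.config_of_len_le (m : Monomial) (b : ℤ) {i : ℕ} (hi : m.len ≤ i) :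
    m.config b i = b := by
  rw [Monomial.config, sum_filter_le_of_le _ hi, add_zero]

theorem Monomial.config_eq_succ (m : Monomial) (b : ℤ) (i : Fin m.len) :
    m.config b i = m.config b (i + 1) + m.sign i := by
  rw [Monomial.config, sum_filter_le_eq, ← add_assoc, Monomial.config]

theorem Monomial.config_succ_eq (m : Monomial) (b : ℤ) (i : Fin m.len) :
    m.config b (i + 1) = m.config b i + 1 ∨ m.config b (i + 1) = m.config b i - 1 := by
  rw [m.config_eq_succ b i]
  rcases Int.units_eq_one_or (m.sign i) with h | h <;> rw [h] <;> simp

/-- A sequence `(r_0, …, r_L)`, continued by the constant `b`. -/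
def extendConfig (b : ℤ) {L : ℕ} (ρ : Fin (L + 1) → ℤ) (i : ℕ) : ℤ :=
  if h : i < L + 1 then ρ ⟨i, h⟩ else b

/-- The least value of `m_{j+1} - m_j` (of `-m_L` for the last entry) in an admissible monomial
of length `L` with configuration `R`. -/
def minGap (p p' : ℕ) (s b : ℤ) (L : ℕ) (R : ℕ → ℤ) (j : ℕ) : ℚ :=
  if j + 1 < L then weight p p' (R j) (R (j + 1)) (R (j + 2))
  else confDim p p' (R j) s - confDim p p' b s

/-- The monomial with configuration `ρ` whose gaps exceed their least values by `k`. -/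
def monomialOf (p p' : ℕ) (s b : ℤ) {L : ℕ} (ρ : Fin (L + 1) → ℤ) (k : Fin L → ℕ) :
    Monomial where
  len := L
  sign i := if extendConfig b ρ i = extendConfig b ρ (i + 1) + 1 then 1 else -1
  mode i := -∑ j ∈ Finset.univ.filter (fun j : Fin L => (i : ℕ) ≤ (j : ℕ)),
        (minGap p p' s b L (extendConfig b ρ) j + k j)

theorem extendConfig_step {p L : ℕ} {r b : ℤ} {ρ : Fin (L + 1) → ℤ} (hρ : ρ ∈ configs p L r b)
    {i : ℕ} (hi : i < L) :
    extendConfig b ρ (i + 1) = extendConfig b ρ i + 1 ∨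
      extendConfig b ρ (i + 1) = extendConfig b ρ i - 1 := by
  rw [extendConfig, dif_pos (by omega), extendConfig, dif_pos (by omega)]
  exact (mem_configs.1 hρ).2.1 ⟨i, hi⟩

theorem extendConfig_of_le {p L : ℕ} {r b : ℤ} {ρ : Fin (L + 1) → ℤ} (hρ : ρ ∈ configs p L r b)
    {i : ℕ} (hi : L ≤ i) : extendConfig b ρ i = b := by
  rw [extendConfig]
  split_ifs with h
  · obtain rfl : i = L := by omega
    exact (mem_configs.1 hρ).2.2.2
  · rfl

theorem config_monomialOf {p p' L : ℕ} {r s b : ℤ} {ρ : Fin (L + 1) → ℤ}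
    (hρ : ρ ∈ configs p L r b) (k : Fin L → ℕ) (i : ℕ) :
    (monomialOf p p' s b ρ k).config b i = extendConfig b ρ i := by
  refine (eq_add_sum_filter (T := extendConfig b ρ) (fun i => extendConfig_of_le hρ)
    (fun i => ?_) i).symm
  simp only [monomialOf]
  rcases extendConfig_step hρ i.2 with h | h
  · rw [if_neg (by omega), h]
    simp
  · rw [if_pos (by omega), h]
    simp

/-- Modulo integers the weight is a second difference of `Δ`. Hence the integrality condition on
each mode follows from the gap conditions and the condition on the last mode. -/
theorem weight_eq_confDim {p p' : ℕ} (ht1 : 1 < (p' : ℚ) / p) (s : ℤ) {a b c : ℤ}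
    (hab : b = a + 1 ∨ b = a - 1) (hbc : c = b + 1 ∨ c = b - 1) :
    ∃ k : ℤ, weight p p' a b c =
      (confDim p p' a s - confDim p p' b s) - (confDim p p' b s - confDim p p' c s) + k := by
  have h1 := confDim_succ_sub ht1 s b
  have h2 := confDim_pred_sub ht1 s b
  rcases hab with h | h
  · obtain rfl : a = b - 1 := by omega
    rcases hbc with rfl | rfl
    · refine ⟨0, ?_⟩
      rw [weight_up_up]
      push_cast
      linarith
    · refine ⟨2 + ⌊(p' : ℚ) / p * ((b - 1 : ℤ) : ℚ)⌋ - s, ?_⟩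
      rw [weight_up_down]
      push_cast
      linarith
  · obtain rfl : a = b + 1 := by omega
    rcases hbc with rfl | rfl
    · refine ⟨1 - ⌊(p' : ℚ) / p * ((b + 1 : ℤ) : ℚ)⌋ + s, ?_⟩
      rw [weight_down_up]
      push_cast
      linarith
    · refine ⟨0, ?_⟩
      rw [weight_down_down]
      push_cast
      linarith

theorem monomialOf_mem {p p' L : ℕ} (ht1 : 1 < (p' : ℚ) / p) {r s b : ℤ}
    {ρ : Fin (L + 1) → ℤ} (hρ : ρ ∈ configs p L r b) (k : Fin L → ℕ) :
    monomialOf p p' s b ρ k ∈ admissibleMonomials p p' s b r := by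
  have hmode : ∀ i : Fin L, -(monomialOf p p' s b ρ k).mode i =
      ∑ j ∈ Finset.univ.filter (fun j : Fin L => (i : ℕ) ≤ (j : ℕ)),
        (minGap p p' s b L (extendConfig b ρ) j + k j) := fun i =>
    neg_neg _
  have hmode1 : ∀ i : Fin L, -(monomialOf p p' s b ρ k).mode i =
      ∑ j ∈ Finset.univ.filter (fun j : Fin L => (i : ℕ) + 1 ≤ (j : ℕ)),
        (minGap p p' s b L (extendConfig b ρ) j + k j) +
        (minGap p p' s b L (extendConfig b ρ) i + k i) := fun i =>
    (hmode i).trans (sum_filter_le_eq _ i)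
  have hlast : ∀ i : Fin L, (i : ℕ) + 1 = L → -(monomialOf p p' s b ρ k).mode i =
      confDim p p' (extendConfig b ρ i) s - confDim p p' b s + k i := by
    intro i hi
    rw [hmode1, sum_filter_le_of_le _ (by omega), zero_add, minGap, if_neg (by omega)]
  have hgap : ∀ i j : Fin L, (j : ℕ) = i + 1 → -(monomialOf p p' s b ρ k).mode i =
      -(monomialOf p p' s b ρ k).mode j + (weight p p' (extendConfig b ρ i)
        (extendConfig b ρ (i + 1)) (extendConfig b ρ (i + 2)) + k i) := by
    intro i j hij
    rw [hmode1 i, hmode j, hij, minGap, if_pos (by omega)]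
  refine ⟨⟨fun i hi1 hi2 => ?_, fun i hlt => ?_, fun i hi => ?_, fun i j hij => ?_⟩, ?_⟩
  · rw [config_monomialOf hρ]
    change i < L at hi2
    rw [extendConfig, dif_pos (by omega)]
    exact (mem_configs.1 hρ).1 _
  · rw [config_monomialOf hρ, config_monomialOf hρ]
    clear hlt
    change Fin L at i
    obtain ⟨i, hi⟩ := i
    -- Induction on the distance to the last mode, adding one gap at a time.
    obtain ⟨n, hn⟩ : ∃ n, L = i + 1 + n := ⟨L - (i + 1), by omega⟩
    induction n generalizing i with
    | zero =>
      refine ⟨k ⟨i, hi⟩, ?_⟩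
      rw [extendConfig_of_le (i := i + 1) hρ (by omega)]
      exact_mod_cast hlast ⟨i, hi⟩ (by simp only; omega)
    | succ n ih =>
      obtain ⟨x, hx⟩ := ih (i + 1) (by omega) (by omega)
      obtain ⟨y, hy⟩ := weight_eq_confDim ht1 s (extendConfig_step hρ (i := i) hi)
        (extendConfig_step hρ (i := i + 1) (by omega))
      refine ⟨x + y + k ⟨i, hi⟩, ?_⟩
      have h1 := hgap ⟨i, hi⟩ ⟨i + 1, by omega⟩ rfl
      simp only at h1 hx hy ⊢
      rw [h1, hx, hy]
      push_cast
      ring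
  · rw [config_monomialOf hρ]
    exact ⟨k i, hlast i hi⟩
  · refine ⟨k i, ?_⟩
    rw [config_monomialOf hρ, config_monomialOf hρ, config_monomialOf hρ, hgap i j hij]
    ring
  · rw [config_monomialOf hρ, extendConfig, dif_pos (by omega)]
    exact (mem_configs.1 hρ).2.2.1

theorem monomialOf_injective {p p' L : ℕ} {r s b : ℤ} {ρ ρ' : Fin (L + 1) → ℤ}
    (hρ : ρ ∈ configs p L r b) (hρ' : ρ' ∈ configs p L r b) {k k' : Fin L → ℕ}
    (h : monomialOf p p' s b ρ k = monomialOf p p' s b ρ' k') : ρ = ρ' ∧ k = k' := by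
  have h1 : ρ = ρ' := by
    ext ⟨i, hi⟩
    have := congrArg (fun m => m.config b i) h
    simpa [config_monomialOf hρ, config_monomialOf hρ', extendConfig, hi] using this
  subst h1
  refine ⟨rfl, ?_⟩
  have h2 : (monomialOf p p' s b ρ k).mode = (monomialOf p p' s b ρ k').mode := by
    simpa only [monomialOf, Monomial.mk.injEq, heq_eq_eq, true_and] using h
  set g := fun j : Fin L => minGap p p' s b L (extendConfig b ρ) j
  have h3 : ∀ i : ℕ, ∑ j ∈ Finset.univ.filter (fun j : Fin L => i ≤ (j : ℕ)), (g j + k j) =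
      ∑ j ∈ Finset.univ.filter (fun j : Fin L => i ≤ (j : ℕ)), (g j + k' j) := by
    intro i
    rcases lt_or_ge i L with hi | hi
    · exact neg_injective (congrFun h2 ⟨i, hi⟩)
    · rw [sum_filter_le_of_le _ hi, sum_filter_le_of_le _ hi]
  ext i
  have h4 := h3 i
  rw [sum_filter_le_eq, sum_filter_le_eq, h3 (i + 1)] at h4
  have : (k i : ℚ) = k' i := by linarith
  exact_mod_cast this

theorem exists_monomialOf_eq {p p' : ℕ} {r s b : ℤ} (hr : r ∈ Set.Icc (1 : ℤ) (p - 1))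
    (hb : b ∈ Set.Icc (1 : ℤ) (p - 1)) {m : Monomial} (hm : m ∈ admissibleMonomials p p' s b r) :
    ∃ ρ ∈ configs p m.len r b, ∃ k : Fin m.len → ℕ, monomialOf p p' s b ρ k = m := by
  obtain ⟨⟨hc, -, hlast, hgap⟩, h0⟩ := hm
  set ρ : Fin (m.len + 1) → ℤ := fun i => m.config b i with hρdef
  have hext : extendConfig b ρ = m.config b := by
    ext i
    rw [extendConfig]
    split_ifs with h
    · rfl
    · exact (m.config_of_len_le b (by omega)).symm
  have hρ : ρ ∈ configs p m.len r b := by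
    rw [mem_configs]
    refine ⟨fun i => ?_, fun i => m.config_succ_eq b i, h0, m.config_of_len_le b le_rfl⟩
    -- Admissibility constrains only the interior vertices; the endpoints are `r` and `b`.
    rcases Nat.eq_zero_or_pos (i : ℕ) with hi | hi
    · simpa [hρdef, hi, h0] using hr
    · rcases (Nat.lt_succ_iff.1 i.2).eq_or_lt with hi' | hi'
      · rw [hρdef]
        simpa only [hi', m.config_of_len_le b le_rfl] using hb
      · exact hc i hi hi'
  -- Extending `-m_i` by `0` past the end makes the condition on `m_L` one more gap condition.
  set T : ℕ → ℚ := fun i => if h : i < m.len then -m.mode ⟨i, h⟩ else 0 with hT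
  have hk : ∀ i : Fin m.len, ∃ k : ℕ,
      T i = T (i + 1) + (minGap p p' s b m.len (m.config b) i + k) := by
    intro i
    by_cases hi : (i : ℕ) + 1 < m.len
    · obtain ⟨k, hk⟩ := hgap i ⟨i + 1, hi⟩ rfl
      refine ⟨k, ?_⟩
      simp only [hT, minGap, dif_pos i.2, dif_pos hi, if_pos hi, ← hk]
      ring
    · obtain ⟨k, hk⟩ := hlast i (by omega)
      refine ⟨k, ?_⟩
      simp only [hT, minGap, dif_pos i.2, dif_neg hi, if_neg hi, ← hk]
      ring
  choose k hk using hk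
  refine ⟨ρ, hρ, k, ?_⟩
  have hsign : (monomialOf p p' s b ρ k).sign = m.sign := by
    ext i
    change Fin m.len at i
    simp only [monomialOf, hext, m.config_eq_succ b i]
    rcases Int.units_eq_one_or (m.sign i) with h | h <;> simp [h]
  have hmode : (monomialOf p p' s b ρ k).mode = m.mode := by
    ext i
    change Fin m.len at i
    have := eq_add_sum_filter (T := T) (c := 0) (fun i hi => dif_neg (by omega)) hk i
    simp only [monomialOf, hext]
    rw [zero_add] at this
    rw [← this]
    simp [hT]
  calc monomialOf p p' s b ρ k = ⟨m.len, (monomialOf p p' s b ρ k).sign,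
        (monomialOf p p' s b ρ k).mode⟩ := rfl
    _ = m := by rw [hsign, hmode]

/-- The gap with index `j` enters the modes `0, …, j`. This is the origin of the factor `i` in the
configuration weight and of the parts `1, …, L` behind `1 / (q)_L`. -/
theorem sum_sum_filter_le {L : ℕ} (f : Fin L → ℚ) :
    ∑ i : Fin L, ∑ j ∈ Finset.univ.filter (fun j : Fin L => (i : ℕ) ≤ (j : ℕ)), f j =
      ∑ j : Fin L, ((j : ℚ) + 1) * f j := by
  simp_rw [Finset.sum_filter]
  rw [Finset.sum_comm]
  refine Finset.sum_congr rfl fun j _ => ?_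
  rw [← Finset.sum_filter, Finset.sum_const, nsmul_eq_mul]
  congr 1
  have : (Finset.univ.filter fun i : Fin L => (i : ℕ) ≤ j) = Finset.Iic j := by
    ext i
    simp
  rw [this, Fin.card_Iic]
  push_cast
  rfl

/-- The minimal value of `-∑ m_i` for an admissible monomial with configuration `ρ`. -/
def minEnergy (p p' : ℕ) (s b : ℤ) {L : ℕ} (ρ : Fin (L + 1) → ℤ) : ℚ :=
  ∑ j : Fin L, ((j : ℚ) + 1) * minGap p p' s b L (extendConfig b ρ) j

theorem degree_monomialOf (p p' : ℕ) (s b : ℤ) {L : ℕ} (ρ : Fin (L + 1) → ℤ) (k : Fin L → ℕ) :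
    (monomialOf p p' s b ρ k).degree p p' s b =
      confDim p p' b s + minEnergy p p' s b ρ + ∑ j : Fin L, ((j : ℚ) + 1) * k j := by
  have : ∑ i, (monomialOf p p' s b ρ k).mode i =
      -∑ i : Fin L, ∑ j ∈ Finset.univ.filter (fun j : Fin L => (i : ℕ) ≤ (j : ℕ)),
        (minGap p p' s b L (extendConfig b ρ) j + (k j : ℚ)) :=
    Finset.sum_neg_distrib _
  rw [Monomial.degree, this, sum_sum_filter_le, sub_neg_eq_add, minEnergy, add_assoc,
    ← Finset.sum_add_distrib]
  simp only [mul_add]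

theorem minEnergy_succ (p p' : ℕ) (s b : ℤ) {L : ℕ} (ρ : Fin (L + 1 + 1) → ℤ) :
    minEnergy p p' s b ρ = configWeight p p' L ρ +
      ((L : ℚ) + 1) * (confDim p p' (ρ (Fin.last L).castSucc) s - confDim p p' b s) := by
  rw [minEnergy, Fin.sum_univ_castSucc, configWeight]
  congr 1
  · refine Finset.sum_congr rfl fun i _ => ?_
    have hi := i.2
    simp only [Fin.val_castSucc, minGap, extendConfig]
    rw [if_pos (by omega), dif_pos (by omega), dif_pos (by omega), dif_pos (by omega)]
    rfl
  · simp only [Fin.val_last, minGap, extendConfig]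
    rw [if_neg (by omega), dif_pos (by omega)]
    rfl

theorem sum_minEnergy {p p' : ℕ} {r s b : ℤ} (hb : b ∈ Set.Icc (1 : ℤ) (p - 1)) (L : ℕ) :
    (∑ ρ : configs p L r b, qpow (confDim p p' b s + minEnergy p p' s b ρ.1)) * (qPoch L)⁻¹ =
      configSumTerm p p' r s b L := by
  rw [Finset.sum_coe_sort (configs p L r b)
    fun ρ => qpow (confDim p p' b s + minEnergy p p' s b ρ)]
  cases L with
  | zero =>
    rw [configSumTerm, qPoch_zero, inv_one, mul_one]
    split_ifs with h
    · subst h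
      have : configs p 0 r r = {fun _ => r} := by
        ext ρ
        rw [mem_configs, Finset.mem_singleton]
        constructor
        · rintro ⟨-, -, h, -⟩
          funext i
          rwa [Subsingleton.elim (α := Fin 1) i 0]
        · rintro rfl
          exact ⟨fun _ => hb, fun i => i.elim0, rfl, rfl⟩
      rw [this, Finset.sum_singleton]
      simp [minEnergy]
    · refine Finset.sum_eq_zero fun ρ hρ => ?_
      obtain ⟨-, -, h1, h2⟩ := mem_configs.1 hρ
      exact absurd (h1.symm.trans h2) h
  | succ L =>
    rw [sum_configs_of_penultimate, configSumTerm, sum_units, Units.val_neg, Units.val_one,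
      ← sub_eq_add_neg, configSum, configSum, mul_right_comm, mul_comm _ (qPoch (L + 1))⁻¹,
      mul_add (qpow _), Finset.mul_sum, Finset.mul_sum, Finset.mul_sum, Finset.mul_sum,
      mul_comm (qPoch (L + 1))⁻¹]
    congr 2 <;>
    · refine Finset.sum_congr rfl fun ρ hρ => ?_
      rw [qpow_mul_qpow, qpow_mul_qpow, minEnergy_succ, (Finset.mem_filter.1 hρ).2,
        add_comm (configWeight p p' L ρ)]

/-- Admissible monomials correspond to configurations together with the excesses of the gaps. -/
noncomputable def admissibleEquiv {p p' : ℕ} (ht1 : 1 < (p' : ℚ) / p) {r s b : ℤ}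
    (hr : r ∈ Set.Icc (1 : ℤ) (p - 1)) (hb : b ∈ Set.Icc (1 : ℤ) (p - 1)) :
    (Σ L, configs p L r b × (Fin L → ℕ)) ≃ admissibleMonomials p p' s b r :=
  Equiv.ofBijective
    (fun x => ⟨monomialOf p p' s b x.2.1.1 x.2.2, monomialOf_mem ht1 x.2.1.2 x.2.2⟩) <| by
    constructor
    · rintro ⟨L, ⟨ρ, hρ⟩, k⟩ ⟨L', ⟨ρ', hρ'⟩, k'⟩ h
      have h1 := Subtype.ext_iff.1 h
      obtain rfl : L = L' := congrArg Monomial.len h1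
      obtain ⟨rfl, rfl⟩ := monomialOf_injective hρ hρ' h1
      rfl
    · rintro ⟨m, hm⟩
      obtain ⟨ρ, hρ, k, h⟩ := exists_monomialOf_eq hr hb hm
      exact ⟨⟨m.len, ⟨ρ, hρ⟩, k⟩, Subtype.ext h⟩

theorem hasFormalSum_admissibleMonomials {p p' : ℕ} (ht1 : 1 < (p' : ℚ) / p) {r s b : ℤ}
    (hr : r ∈ Set.Icc (1 : ℤ) (p - 1)) (hb : b ∈ Set.Icc (1 : ℤ) (p - 1)) {F : QSeries}
    (h : HasFormalSum (configSumTerm p p' r s b) F) :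
    HasFormalSum (fun m : admissibleMonomials p p' s b r => qpow (m.1.degree p p' s b)) F := by
  have h1 : HasFormalSum (fun x : Σ L, configs p L r b × (Fin L → ℕ) =>
      qpow ((monomialOf p p' s b x.2.1.1 x.2.2).degree p p' s b)) F := by
    -- At fixed `L` the index set is a product of paths and excess tuples, so the fibre sum factors.
    refine .of_sigma (fun x => nonnegCoeff_qpow _) (fun L => ?_) h
    refine ((HasFormalSum.of_fintype fun ρ : configs p L r b =>
      qpow (confDim p p' b s + minEnergy p p' s b ρ.1)).mul (hasFormalSum_inv_qPoch L)).congr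
      (fun x => ?_) (sum_minEnergy hb L)
    rw [degree_monomialOf, qpow_mul_qpow]
  refine (h1.comp_equiv (admissibleEquiv ht1 hr hb).symm).congr (fun m => ?_) rfl
  obtain ⟨x, rfl⟩ := (admissibleEquiv (s := s) ht1 hr hb).surjective m
  rw [Equiv.symm_apply_apply]
  rfl

end VirasoroMonomials

open VirasoroMonomials
theorem mainTheorem7 (p p' : ℕ) (hcop : Nat.Coprime p p')
    (ht1 : 1 < (p' : ℚ) / p) (ht2 : (p' : ℚ) / p < 2)
    (r s b : ℤ) (hr : r ∈ Set.Icc (1 : ℤ) (p - 1)) (hs : s ∈ Set.Icc (1 : ℤ) (p' - 1))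
    (hb : IsMinimizer p p' s b) :
    -- the generating function of admissible monomials is the bosonic character
    HasFormalSum (fun m : admissibleMonomials p p' s b r => qpow (m.1.degree p p' s b))
      (character p p' r s) ∧
    -- its expression through one-dimensional configuration sums
    HasFormalSum (configSumTerm p p' r s b) (character p p' r s) ∧
    -- the fermionic formula with `b = b(s)`
    HasFormalSum (fun L : ℕ =>
        qpow (confDim p p' r s + ((L : ℚ) ^ 2 - (r - b) ^ 2) / 4) * (qPoch L)⁻¹ *
          fermionicSum p p' r s b L)
      (character p p' r s) ∧
    -- for each `L` the sum over `n` has nonnegative coefficients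
    ∀ (L : ℕ) (d : ℚ), 0 ≤ (fermionicSum p p' r s b L).coeff d := by
  have h1 := hasFormalSum_fermionicSum ht1 hr hs b
  have h2 : HasFormalSum (configSumTerm p p' r s b) (character p p' r s) :=
    h1.congr (fun L => (configSumTerm_eq ht1 ht2 hr hs hb L).symm) rfl
  exact ⟨hasFormalSum_admissibleMonomials ht1 hr hb.1 h2, h2, h1,
    nonnegCoeff_fermionicSum ht1 ht2 hr hs hb⟩
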